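/- Let $F_0$ be a non-archimedean local field of odd residual characteristic, with ring of integers $\mathfrak o_0$, maximal ideal $\mathfrak p_0$, residue field $k_0$ and uniformizer $\varpi$. Let $F=F_0[\sqrt\varepsilon]$, with $\varepsilon\in\mathfrak o_0^\times$ a nonsquare, be the unramified quadratic extension, with $\mathfrak o_F,\mathfrak p_F,k_F$ defined likewise; write $x\mapsto\bar x$ for the Galois conjugation on $F$ and on $k_F$. Put $V=F^4$ with standard basis $e_1,\dots,e_4$, $A=M_4(F)$, $H=E_{14}+E_{23}+E_{32}+E_{41}$, $f(x,y)={}^t\bar x Hy$, $\sigma(X)=H^{-1}\,{}^t\overline X H$, $G=U(2,2)=\{g\in GL_4(F): g\sigma(g)=1\}$ and $\mathfrak g=\{X\in A: X+\sigma(X)=0\}$. Fix an additive character $\Omega$ of $F_0$ that is trivial on $\mathfrak p_0$ but not on $\mathfrak o_0$. An $\mathfrak o_F$-lattice sequence of period $e$ is a decreasing map $\Lambda$ from $\mathbf Z$ to the $\mathfrak o_F$-lattices in $V$ with $\varpi\Lambda(i)=\Lambda(i+e)$ for all $i$. With $L^\#=\{v\in V: f(v,L)\subset\mathfrak o_F\}$,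 it is self-dual if for some $d\in\mathbf Z$ one has $\Lambda(i)^\#=\Lambda(d-i)$ for all $i$. Put $\mathfrak a_k(\Lambda)=\{X\in A: X\Lambda(i)\subset\Lambda(i+k)\ \forall i\}$ for $k\in\mathbf Z$, and $P_{\Lambda,k}=G\cap(1+\mathfrak a_k(\Lambda))$ for $k\ge1$. For integers $n>r\geq 0$, a skew stratum $[\Lambda,n,r,\beta]$ consists of a self-dual lattice sequence $\Lambda$, the integers $n$ and $r$, and an element $\beta\in\mathfrak g\cap\mathfrak a_{-n}(\Lambda)$. Let $e$ be the period of $\Lambda$ and $k=\gcd(e,n)$. The characteristic polynomial $\phi_\beta\in k_F[X]$ of the stratum is the reduction modulo $\mathfrak p_F$ of the characteristic polynomial of $y_\beta=\varpi^{n/k}\beta^{e/k}$ (which lies in $\mathfrak o_F[X]$). The stratum is fundamental if $\phi_\beta\ne X^4$. If moreover $r\ge[n/2]$, a smooth complex representation $\pi$ of $G$ contains $[\Lambda,n,r,\beta]$ if there is a nonzero vector on which $P_{\Lambda,r+1}$ acts through the character $\psi_\beta(p)=\Omega\bigl(\mathrm{tr}_{F/F_0}\,\mathrm{tr}(\beta(p-1))\bigr)$.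 Let $N_0=\mathfrak o_Fe_1\oplus\mathfrak o_Fe_2\oplus\mathfrak o_Fe_3\oplus\mathfrak o_Fe_4$, $N_1=\mathfrak o_Fe_1\oplus\mathfrak o_Fe_2\oplus\mathfrak o_Fe_3\oplus\mathfrak p_Fe_4$ and $N_2=\mathfrak o_Fe_1\oplus\mathfrak o_Fe_2\oplus\mathfrak p_Fe_3\oplus\mathfrak p_Fe_4$. Let $\Lambda,\Lambda'$ be the self-dual lattice sequences of period $2$ given by $$\Lambda(2i)=\varpi^iN_0,\quad \Lambda(2i+1)=\varpi^iN_2,\qquad \Lambda'(2i)=\varpi^iN_1,\quad \Lambda'(2i+1)=\varpi^{i+1}N_1^\#\qquad(i\in\mathbf Z).$$ **Lemma 4.1.** Let $m$ be a positive integer and $n=2m-1$. Let $[\Lambda',n,n-1,\beta']$ be a fundamental skew stratum whose characteristic polynomial is either (a) $(X-\lambda)^2(X-\bar\lambda)^2$ with $\lambda\in k_F$, $\lambda\neq\bar\lambda$, or (c) $(X-u)^4$ with $u\in k_0^\times$. Suppose that an irreducible smooth complex representation $\pi$ of $G$ contains $[\Lambda',n,n-1,\beta']$. Then there exists a fundamental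 skew stratum $[\Lambda,n,n-1,\beta]$ which is contained in $\pi$. -/

import Mathlib

open ValuativeRel Polynomial
open scoped Pointwise Matrix

namespace UnitaryStrata

noncomputable section

section Space

variable {F₀ F : Type*} [Field F₀] [Field F] [Algebra F₀ F]

/-- The matrix `H = E₁₄ + E₂₃ + E₃₂ + E₄₁`. -/
def formMatrix (F : Type*) [Field F] : Matrix (Fin 4) (Fin 4) F :=
  !![0, 0, 0, 1; 0, 0, 1, 0; 0, 1, 0, 0; 1, 0, 0, 0]

theorem formMatrix_mul_self : formMatrix F * formMatrix F = 1 := by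
  ext i j
  fin_cases i <;> fin_cases j <;> simp [formMatrix, Matrix.mul_apply, Fin.sum_univ_four]

/-- The hermitian form `f(x, y) = ᵗx̄ H y` on `F⁴`, where `c` is the Galois conjugation of
`F / F₀`. -/
def form (c : F ≃ₐ[F₀] F) (x y : Fin 4 → F) : F :=
  (fun i => c (x i)) ⬝ᵥ (formMatrix F *ᵥ y)

/-- The involution `σ(X) = H⁻¹ ᵗX̄ H` on `M₄(F)`; here `H⁻¹ = H`. -/
def sigma (c : F ≃ₐ[F₀] F) (X : Matrix (Fin 4) (Fin 4) F) : Matrix (Fin 4) (Fin 4) F :=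
  formMatrix F * (X.map c)ᵀ * formMatrix F

theorem sigma_mul (c : F ≃ₐ[F₀] F) (X Y : Matrix (Fin 4) (Fin 4) F) :
    sigma c (X * Y) = sigma c Y * sigma c X := by
  have h : (X * Y).map c = X.map c * Y.map c := by
    ext i j
    simp [Matrix.mul_apply, map_sum]
  have hH := formMatrix_mul_self (F := F)
  calc sigma c (X * Y)
      = formMatrix F * (Y.map c)ᵀ * 1 * (X.map c)ᵀ * formMatrix F := by
        rw [sigma, h, Matrix.transpose_mul, Matrix.mul_one]
        simp only [Matrix.mul_assoc]
    _ = sigma c Y * sigma c X := by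
        rw [← hH]
        simp only [sigma, Matrix.mul_assoc]

theorem sigma_one (c : F ≃ₐ[F₀] F) : sigma c (1 : Matrix (Fin 4) (Fin 4) F) = 1 := by
  have h : (1 : Matrix (Fin 4) (Fin 4) F).map c = 1 := by
    ext i j
    by_cases hij : i = j <;> simp [Matrix.one_apply, hij]
  rw [sigma, h, Matrix.transpose_one, Matrix.mul_one, formMatrix_mul_self]

/-- The unramified unitary group `G = U(2,2) = {g ∈ GL₄(F) | g σ(g) = 1}`. As a subgroup of
`GL₄(F)` it carries the subspace topology. -/
def U22 (c : F ≃ₐ[F₀] F) : Subgroup (GL (Fin 4) F) where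
  carrier := {g | (g : Matrix (Fin 4) (Fin 4) F) * sigma c (g : Matrix (Fin 4) (Fin 4) F) = 1}
  one_mem' := by
    show ((1 : GL (Fin 4) F) : Matrix (Fin 4) (Fin 4) F) * sigma c _ = 1
    rw [Units.val_one, sigma_one, Matrix.mul_one]
  mul_mem' := by
    intro a b ha hb
    show ((a * b : GL (Fin 4) F) : Matrix (Fin 4) (Fin 4) F) * sigma c _ = 1
    have hb' : (b : Matrix (Fin 4) (Fin 4) F) * sigma c (b : Matrix (Fin 4) (Fin 4) F) = 1 := hb
    rw [Units.val_mul, sigma_mul, Matrix.mul_assoc,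
      ← Matrix.mul_assoc (b : Matrix (Fin 4) (Fin 4) F) (sigma c (b : Matrix (Fin 4) (Fin 4) F)),
      hb', Matrix.one_mul]
    exact ha
  inv_mem' := by
    intro a ha
    have ha' : (a : Matrix (Fin 4) (Fin 4) F) * sigma c (a : Matrix (Fin 4) (Fin 4) F) = 1 := ha
    show ((a⁻¹ : GL (Fin 4) F) : Matrix (Fin 4) (Fin 4) F) * sigma c _ = 1
    have h1 : sigma c (a : Matrix (Fin 4) (Fin 4) F)
        = ((a⁻¹ : GL (Fin 4) F) : Matrix (Fin 4) (Fin 4) F) :=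
      (Units.inv_eq_of_mul_eq_one_right ha').symm
    have h2 : sigma c ((a⁻¹ : GL (Fin 4) F) : Matrix (Fin 4) (Fin 4) F)
        * sigma c (a : Matrix (Fin 4) (Fin 4) F) = 1 := by
      rw [← sigma_mul, Units.mul_inv, sigma_one]
    rw [h1] at h2
    exact mul_eq_one_comm.mp h2

/-- The Lie algebra `𝔤 = {X ∈ M₄(F) | X + σ(X) = 0}` of `G`. -/
def lieG (c : F ≃ₐ[F₀] F) : Set (Matrix (Fin 4) (Fin 4) F) := {X | X + sigma c X = 0}

end Space

section Lattices

variable {F₀ F : Type*} [Field F₀] [Field F] [Algebra F₀ F] [ValuativeRel F]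

/-- The dual `L^#` of a lattice `L`. It is written as `{v | f(L, v) ⊆ 𝔬_F}`, which is the same
as `{v | f(v, L) ⊆ 𝔬_F}` since `f` is hermitian and conjugation preserves `𝔬_F`. -/
def dual (c : F ≃ₐ[F₀] F) (L : Submodule 𝒪[F] (Fin 4 → F)) : Submodule 𝒪[F] (Fin 4 → F) where
  carrier := {v | ∀ w ∈ L, form c w v ∈ 𝒪[F]}
  zero_mem' := by
    intro w _
    simp only [form, Matrix.mulVec_zero, dotProduct_zero]
    exact zero_mem _
  add_mem' := by
    intro a b ha hb w hw
    simp only [form, Matrix.mulVec_add, dotProduct_add]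
    exact add_mem (ha w hw) (hb w hw)
  smul_mem' := by
    intro r a ha w hw
    have h : form c w (r • a) = (r : F) * form c w a := by
      have : r • a = (r : F) • a := rfl
      simp only [form, this, Matrix.mulVec_smul, dotProduct_smul, smul_eq_mul]
    rw [h]
    exact mul_mem r.2 (ha w hw)

/-- `Λ` is an `𝔬_F`-lattice sequence in `V = F⁴` of period `e` (with respect to the
uniformizer `ϖ`). An `𝔬_F`-lattice in `V` is a finitely generated `𝔬_F`-submodule spanning `V`
over `F`. The period of a lattice sequence is unique and positive. -/
structure IsLatticeSequence (ϖ : F) (Λ : ℤ → Submodule 𝒪[F] (Fin 4 → F)) (e : ℕ) : Prop where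
  fg : ∀ i, (Λ i).FG
  span_eq_top : ∀ i, Submodule.span F (Λ i : Set (Fin 4 → F)) = ⊤
  antitone : ∀ i, Λ (i + 1) ≤ Λ i
  period : ∀ i, ϖ • Λ i = Λ (i + e)

/-- `Λ` is self-dual: there is an integer `d` with `Λ(i)^# = Λ(d - i)` for all `i`. -/
def IsSelfDual (c : F ≃ₐ[F₀] F) (Λ : ℤ → Submodule 𝒪[F] (Fin 4 → F)) : Prop :=
  ∃ d : ℤ, ∀ i, dual c (Λ i) = Λ (d - i)

/-- The filtration `𝔞_n(Λ) = {X ∈ M₄(F) | X Λ(i) ⊆ Λ(i + n) for all i}`. -/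
def filtration (Λ : ℤ → Submodule 𝒪[F] (Fin 4 → F)) (n : ℤ) :
    Set (Matrix (Fin 4) (Fin 4) F) :=
  {X | ∀ i, ∀ v ∈ Λ i, X *ᵥ v ∈ Λ (i + n)}

/-- For `n ≥ 1`, the subgroup `P_{Λ,n} = G ∩ (1 + 𝔞_n(Λ))` of `G`. -/
def P (c : F ≃ₐ[F₀] F) (Λ : ℤ → Submodule 𝒪[F] (Fin 4 → F)) (n : ℕ) : Set (U22 c) :=
  {p | ((p : GL (Fin 4) F) : Matrix (Fin 4) (Fin 4) F) - 1 ∈ filtration Λ n}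

/-- The lattice `N_k`: the vectors whose first `4 - k` coordinates lie in `𝔬_F` and whose last
`k` coordinates lie in `𝔭_F`. So `N_0 = 𝔬e₁ ⊕ 𝔬e₂ ⊕ 𝔬e₃ ⊕ 𝔬e₄`,
`N_1 = 𝔬e₁ ⊕ 𝔬e₂ ⊕ 𝔬e₃ ⊕ 𝔭e₄` and `N_2 = 𝔬e₁ ⊕ 𝔬e₂ ⊕ 𝔭e₃ ⊕ 𝔭e₄`. -/
def N (F : Type*) [Field F] [ValuativeRel F] (k : ℕ) : Submodule 𝒪[F] (Fin 4 → F) :=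
  Submodule.pi Set.univ fun i =>
    if (i : ℕ) + k < 4 then LinearMap.range (Algebra.linearMap 𝒪[F] F)
    else Submodule.map (Algebra.linearMap 𝒪[F] F) 𝓂[F]

/-- The lattice sequence `Λ(2i) = ϖⁱ N_0`, `Λ(2i + 1) = ϖⁱ N_2`. -/
def seqN0N2 (ϖ : F) (i : ℤ) : Submodule 𝒪[F] (Fin 4 → F) :=
  if Even i then ϖ ^ (i / 2) • N F 0 else ϖ ^ (i / 2) • N F 2

/-- The lattice sequence `Λ'(2i) = ϖⁱ N_1`, `Λ'(2i + 1) = ϖⁱ⁺¹ N_1^#`. -/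
def seqN1 (c : F ≃ₐ[F₀] F) (ϖ : F) (i : ℤ) : Submodule 𝒪[F] (Fin 4 → F) :=
  if Even i then ϖ ^ (i / 2) • N F 1 else ϖ ^ (i / 2 + 1) • dual c (N F 1)

end Lattices

section Strata

variable {F₀ F : Type*} [Field F₀] [Field F] [Algebra F₀ F] [ValuativeRel F]

/-- `[Λ, n, r, β]` is a skew stratum in `M₄(F)`, where `e` is the period of `Λ`. -/
structure IsSkewStratum (c : F ≃ₐ[F₀] F) (ϖ : F) (Λ : ℤ → Submodule 𝒪[F] (Fin 4 → F)) (e : ℕ)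
    (n r : ℕ) (β : Matrix (Fin 4) (Fin 4) F) : Prop where
  isLatticeSequence : IsLatticeSequence ϖ Λ e
  lt : r < n
  isSelfDual : IsSelfDual c Λ
  mem_filtration : β ∈ filtration Λ (-(n : ℤ))
  mem_lieG : β ∈ lieG c

/-- The element `y_β = ϖ^(n/k) β^(e/k)` with `k = gcd(e, n)`. -/
def yElt (ϖ : F) (e n : ℕ) (β : Matrix (Fin 4) (Fin 4) F) : Matrix (Fin 4) (Fin 4) F :=
  ϖ ^ (n / Nat.gcd e n) • β ^ (e / Nat.gcd e n)

/-- `φ ∈ k_F[X]` is the characteristic polynomial of the stratum `[Λ, n, r, β]` (`e` the period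
of `Λ`): the characteristic polynomial `Φ` of `y_β` has coefficients in `𝔬_F`, and `φ` is its
reduction modulo `𝔭_F`. There is at most one such `φ`. -/
def IsStratumCharpoly (ϖ : F) (e n : ℕ) (β : Matrix (Fin 4) (Fin 4) F) (φ : 𝓀[F][X]) : Prop :=
  ∃ Φ : 𝒪[F][X], Φ.map (algebraMap 𝒪[F] F) = (yElt ϖ e n β).charpoly ∧
    Φ.map (IsLocalRing.residue 𝒪[F]) = φ

/-- `[Λ, n, r, β]` is a fundamental skew stratum: its characteristic polynomial is not `X⁴`. -/
def IsFundamentalSkewStratum (c : F ≃ₐ[F₀] F) (ϖ : F) (Λ : ℤ → Submodule 𝒪[F] (Fin 4 → F))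
    (e : ℕ) (n r : ℕ) (β : Matrix (Fin 4) (Fin 4) F) : Prop :=
  IsSkewStratum c ϖ Λ e n r β ∧ ∃ φ : 𝓀[F][X], IsStratumCharpoly ϖ e n β φ ∧ φ ≠ X ^ 4

/-- `φ = (X - λ)² (X - λ̄)²` with `λ ∈ k_F`, `λ ≠ λ̄`. Here `l` is a lift of `λ` to `𝔬_F`, and
`l'` is the conjugate of `l`. -/
def IsTypeA (c : F ≃ₐ[F₀] F) (φ : 𝓀[F][X]) : Prop :=
  ∃ l l' : 𝒪[F], (l' : F) = c l ∧ IsLocalRing.residue 𝒪[F] l ≠ IsLocalRing.residue 𝒪[F] l' ∧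
    φ = (X - C (IsLocalRing.residue 𝒪[F] l)) ^ 2 * (X - C (IsLocalRing.residue 𝒪[F] l')) ^ 2

/-- `φ = (X - u)⁴` with `u ∈ k₀ˣ`. Here `a` is a unit of `𝔬₀` lifting `u`, and `a'` is `a`
regarded as an element of `𝔬_F`. -/
def IsTypeC (F₀ : Type*) {F : Type*} [Field F₀] [Field F] [Algebra F₀ F] [ValuativeRel F₀]
    [ValuativeRel F] (φ : 𝓀[F][X]) : Prop :=
  ∃ (a : 𝒪[F₀]) (a' : 𝒪[F]), IsUnit a ∧ (a' : F) = algebraMap F₀ F a ∧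
    φ = (X - C (IsLocalRing.residue 𝒪[F] a')) ^ 4

end Strata

section Representations

variable {F₀ F : Type*} [Field F₀] [Field F] [Algebra F₀ F]

/-- The additive character `Ω` of `F₀` has conductor `𝔭₀`: it is trivial on `𝔭₀` and not on
`𝔬₀`. -/
def HasConductorPrime [ValuativeRel F₀] (Ω : AddChar F₀ Circle) : Prop :=
  (∀ x : 𝒪[F₀], x ∈ 𝓂[F₀] → Ω x = 1) ∧ ∃ x : 𝒪[F₀], Ω x ≠ 1

/-- `ψ_β(p) = Ω(tr_{F/F₀} (tr (β (p - 1))))`. -/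
def psi (c : F ≃ₐ[F₀] F) (Ω : AddChar F₀ Circle) (β : Matrix (Fin 4) (Fin 4) F) (p : U22 c) : ℂ :=
  (Ω (Algebra.trace F₀ F
    (β * (((p : GL (Fin 4) F) : Matrix (Fin 4) (Fin 4) F) - 1)).trace) : ℂ)

variable {c : F ≃ₐ[F₀] F} {W : Type*} [AddCommGroup W] [Module ℂ W]

/-- A complex representation of `G` is smooth if all its vectors have open stabilizers. -/
def IsSmoothRep [TopologicalSpace F] (π : Representation ℂ (U22 c) W) : Prop :=
  ∀ w : W, IsOpen {g : U22 c | π g w = w}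

/-- `π` contains the skew stratum `[Λ, n, r, β]` (where `n > r ≥ [n/2]`): the restriction of `π`
to `P_{Λ,r+1}` contains the character `ψ_β`. -/
def ContainsStratum [ValuativeRel F] (Ω : AddChar F₀ Circle) (π : Representation ℂ (U22 c) W)
    (Λ : ℤ → Submodule 𝒪[F] (Fin 4 → F)) (r : ℕ) (β : Matrix (Fin 4) (Fin 4) F) : Prop :=
  ∃ w : W, w ≠ 0 ∧ ∀ p ∈ P c Λ (r + 1), π p w = psi c Ω β p • w

end Representations

end

end UnitaryStrata

/-!
In the chain `Λ'` the graded pieces are the hermitian planes `W₂ = ⟨e₂, e₃⟩` and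
`W₁ = ⟨e₁, ϖ e₄⟩` over `k_F`. An element `β'` of `𝔞_{-n}(Λ') ∩ 𝔤` with `n` odd induces a map
`A : W₂ → W₁` and, up to sign, its adjoint `W₁ → W₂`; the characteristic polynomial of the stratum
is the square of the one of the self-adjoint operator `T = -A*A` of `W₂`. The forms `⟨x, y⟩` and
`⟨A x, A y⟩` have a common isotropic line as soon as the discriminant of `T` is the square of an
element `μ` with `μ̄ = -μ`: the line is spanned by `e₂ + x e₃`, with `x̄ = -x` a root of a quadratic
equation, or by `e₃`. For the types (a) and (c) one has `μ = λ - λ̄` and `μ = 0` respectively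
(`discr_mem`, `exists_roots_of_type`). Conjugating by elements of the parahoric subgroup of `Λ'` one
may move this line to `⟨e₂⟩` and its image into `⟨ϖ e₄⟩`
(`IsContainedStratum.exists_isotropic`, `IsContainedStratum.exists_entry_mem`), that is, assume
that the entry `(1, 2)` of `β'` is small.

Then `β'` lies in `𝔞_{-n}(Λ)` as well. The group `P_{Λ,n}` need not act on the given vector by a
character, but `P_{Λ,n} ∩ P_{Λ',n}` does, through `ψ_{β'}`; its index in `P_{Λ,n}` is finite, being
controlled by two entries modulo `𝔭_F`. The characters `ψ_β` of `P_{Λ,n}`, where `β` differs from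
`β'` in the two dual entries, all restrict to `ψ_{β'}`, and by orthogonality their sum vanishes off
the intersection, so one of them occurs in `π` (`exists_eigenvector_of_sum_eq_zero`,
`exists_containsStratum_perturb`). The two entries do not contribute to the leading term of
`det β`, which is nonzero for `β'` because `λ ≠ 0`; hence the new stratum is fundamental
(`isFundamental_perturb`).

All conditions on lattices and matrices are translated into conditions on the valuations of
coordinates and entries (`mem_filtration_latSeq`); the uniformizer of `F₀` is one of `F`, and
conjugation preserves `𝔬_F`, because the norm form of `F / F₀` takes unit values at primitive
vectors, by Hensel's lemma (`isUnramifiedPair`). Comments number the basis vectors and the matrix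
entries from `1`, whereas the indices in `Fin 4` start from `0`.
-/

namespace UnitaryStrata

/-! ### Unramified quadratic extensions of odd residual characteristic -/


section IntegerRing

variable {K : Type*} [Field K] [ValuativeRel K]

theorem mem_integer_or_inv_mem (x : K) :
    x ∈ 𝒪[K] ∨ x⁻¹ ∈ 𝒪[K] := by
  rw [Valuation.mem_integer_iff, Valuation.mem_integer_iff]
  rcases eq_or_ne x 0 with rfl | h
  · simp
  · rw [map_inv₀]
    rcases le_total (valuation K x) 1 with h1 | h1
    · exact Or.inl h1
    · exact Or.inr (inv_le_one_of_one_le₀ h1)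

theorem mem_integer_of_sq_mem {x : K}
    (h : x ^ 2 ∈ 𝒪[K]) : x ∈ 𝒪[K] := by
  rw [Valuation.mem_integer_iff, map_pow] at h
  rw [Valuation.mem_integer_iff]
  by_contra h1
  exact absurd h (not_le.2 (one_lt_pow₀ (not_le.1 h1) two_ne_zero))

theorem isUnit_integer_iff (x : 𝒪[K]) :
    IsUnit x ↔ (x : K) ≠ 0 ∧ (x : K)⁻¹ ∈ 𝒪[K] := by
  constructor
  · rintro ⟨u, rfl⟩
    have h : ((u : 𝒪[K]) : K) * ((u⁻¹ : 𝒪[K]ˣ) : 𝒪[K]) = 1 := by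
      rw [← Subring.coe_mul, Units.mul_inv]; rfl
    refine ⟨left_ne_zero_of_mul_eq_one h, ?_⟩
    rw [inv_eq_of_mul_eq_one_right h]
    exact Subtype.prop _
  · rintro ⟨h0, h⟩
    refine IsUnit.of_mul_eq_one (⟨_, h⟩ : 𝒪[K]) (Subtype.ext ?_)
    simp [h0]

end IntegerRing

section QuadraticExtension

variable {F₀ F : Type*} [Field F₀] [ValuativeRel F₀] [Field F] [Algebra F₀ F]
  {ε : 𝒪[F₀]} {s : F}

theorem exists_eq_add_mul (hs : s ^ 2 = algebraMap F₀ F ε)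
    (hF : Algebra.adjoin F₀ {s} = ⊤) (x : F) :
    ∃ a b : F₀, x = algebraMap F₀ F a + algebraMap F₀ F b * s := by
  have hx : x ∈ Algebra.adjoin F₀ {s} := by rw [hF]; trivial
  induction hx using Algebra.adjoin_induction with
  | mem x hx => exact ⟨0, 1, by simpa using hx⟩
  | algebraMap r => exact ⟨r, 0, by simp⟩
  | add x y _ _ hx hy =>
    obtain ⟨a, b, rfl⟩ := hx
    obtain ⟨a', b', rfl⟩ := hy
    exact ⟨a + a', b + b', by simp only [map_add]; ring⟩
  | mul x y _ _ hx hy =>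
    obtain ⟨a, b, rfl⟩ := hx
    obtain ⟨a', b', rfl⟩ := hy
    refine ⟨a * a' + b * b' * ε, a * b' + a' * b, ?_⟩
    simp only [map_add, map_mul]
    linear_combination (algebraMap F₀ F b * algebraMap F₀ F b') * hs

theorem conj_sqrt (hs : s ^ 2 = algebraMap F₀ F ε) (hF : Algebra.adjoin F₀ {s} = ⊤)
    {c : F ≃ₐ[F₀] F} (hc : c ≠ AlgEquiv.refl) : c s = -s := by
  have h : (c s) ^ 2 = s ^ 2 := by rw [← map_pow, hs, AlgEquiv.commutes]
  rcases sq_eq_sq_iff_eq_or_eq_neg.1 h with h | h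
  · exfalso
    apply hc
    ext x
    obtain ⟨a, b, rfl⟩ := exists_eq_add_mul hs hF x
    simp [h]
  · exact h

variable [ValuativeRel F] [ValuativeExtension F₀ F]

theorem algebraMap_mem_integer_iff {a : F₀} : algebraMap F₀ F a ∈ 𝒪[F] ↔ a ∈ 𝒪[F₀] := by
  rw [Valuation.mem_integer_iff, Valuation.mem_integer_iff, ← (valuation F).vle_one_iff,
    ← (valuation F₀).vle_one_iff, ← ValuativeExtension.vle_iff_vle (A := F₀) (B := F), map_one]

theorem sqrt_mem_integer (hs : s ^ 2 = algebraMap F₀ F ε) : s ∈ 𝒪[F] :=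
  mem_integer_of_sq_mem (by rw [hs]; exact algebraMap_mem_integer_iff.2 ε.2)

end QuadraticExtension

section Unramified

variable {F₀ F : Type*} [Field F₀] [ValuativeRel F₀] [TopologicalSpace F₀]
  [IsNonarchimedeanLocalField F₀]

theorem isUnit_two_integer (hodd : ringChar 𝓀[F₀] ≠ 2) : IsUnit (2 : 𝒪[F₀]) := by
  by_contra h
  have h1 : (2 : 𝒪[F₀]) ∈ 𝓂[F₀] := (IsLocalRing.mem_maximalIdeal _).2 h
  have h2 := (IsLocalRing.residue_eq_zero_iff (2 : 𝒪[F₀])).2 h1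
  rw [map_ofNat] at h2
  exact Ring.two_ne_zero hodd h2

/-- Hensel's lemma for square roots: a unit which is a square modulo `𝔭₀` is a square. -/
theorem isSquare_of_sq_sub_mem (hodd : ringChar 𝓀[F₀] ≠ 2) {ε u : 𝒪[F₀]} (hε : IsUnit ε)
    (hu : u ^ 2 - ε ∈ 𝓂[F₀]) : IsSquare ε := by
  let := IsTopologicalAddGroup.rightUniformSpace F₀
  have := isUniformAddGroup_of_addCommGroup (G := F₀)
  have huu : IsUnit u := by
    by_contra h
    have h1 : u ∈ 𝓂[F₀] := (IsLocalRing.mem_maximalIdeal _).2 h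
    have h2 : ε ∈ 𝓂[F₀] := by
      have := sub_mem (Ideal.mul_mem_left _ u h1) hu
      have e : u * u - (u ^ 2 - ε) = ε := by ring
      rwa [e] at this
    exact (IsLocalRing.mem_maximalIdeal _).1 h2 hε
  obtain ⟨a, ha, -⟩ := HenselianRing.is_henselian (I := 𝓂[F₀]) (X ^ 2 - C ε : 𝒪[F₀][X])
    (monic_X_pow_sub_C ε two_ne_zero) u (by simpa using hu)
    (by
      have : (derivative (X ^ 2 - C ε : 𝒪[F₀][X])).eval u = 2 * u := by
        simp [one_add_one_eq_two]
      rw [this]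
      exact ((isUnit_two_integer hodd).mul huu).map _)
  refine ⟨a, ?_⟩
  have : a ^ 2 - ε = 0 := by simpa [IsRoot] using ha
  rw [← pow_two]
  exact (sub_eq_zero.1 this).symm

/-- If `ε` is not a square, the norm form `u² - ε w²` takes unit values at primitive vectors. -/
theorem isUnit_sq_sub_mul_sq (hodd : ringChar 𝓀[F₀] ≠ 2) {ε : 𝒪[F₀]} (hε : IsUnit ε)
    (hε' : ¬ IsSquare ε) {u w : 𝒪[F₀]} (h : u = 1 ∨ w = 1) : IsUnit (u ^ 2 - ε * w ^ 2) := by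
  by_contra hn
  have hm : u ^ 2 - ε * w ^ 2 ∈ 𝓂[F₀] := (IsLocalRing.mem_maximalIdeal _).2 hn
  apply hε'
  rcases h with rfl | rfl
  · apply isSquare_of_sq_sub_mem hodd hε (u := ε * w)
    have := Ideal.mul_mem_left _ (-ε) hm
    have e : -ε * (1 ^ 2 - ε * w ^ 2) = (ε * w) ^ 2 - ε := by ring
    rwa [e] at this
  · apply isSquare_of_sq_sub_mem hodd hε (u := u)
    simpa using hm

variable [Field F] [ValuativeRel F] [Algebra F₀ F] [ValuativeExtension F₀ F]

variable {ε : 𝒪[F₀]} {s : F}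

/-- A primitive vector `u + w √ε` is a unit, because its norm is one. -/
theorem inv_add_mul_mem (hodd : ringChar 𝓀[F₀] ≠ 2) (hε : IsUnit ε)
    (hε' : ¬ IsSquare ε) (hs : s ^ 2 = algebraMap F₀ F ε) {u w : F₀} (hu : u ∈ 𝒪[F₀])
    (hw : w ∈ 𝒪[F₀]) (h : u = 1 ∨ w = 1) :
    algebraMap F₀ F u + algebraMap F₀ F w * s ≠ 0 ∧
      (algebraMap F₀ F u + algebraMap F₀ F w * s)⁻¹ ∈ 𝒪[F] := by
  have hunit : IsUnit ((⟨u, hu⟩ : 𝒪[F₀]) ^ 2 - ε * (⟨w, hw⟩ : 𝒪[F₀]) ^ 2) :=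
    isUnit_sq_sub_mul_sq hodd hε hε' (h.imp Subtype.ext Subtype.ext)
  obtain ⟨h0, h1⟩ := (isUnit_integer_iff _).1 hunit
  have h1' : (u ^ 2 - ε * w ^ 2)⁻¹ ∈ 𝒪[F₀] := h1
  have h0' : algebraMap F₀ F (u ^ 2 - ε * w ^ 2) ≠ 0 :=
    (map_ne_zero_iff _ (algebraMap F₀ F).injective).2 h0
  have e : algebraMap F₀ F (u ^ 2 - ε * w ^ 2) = (algebraMap F₀ F u + algebraMap F₀ F w * s)
      * (algebraMap F₀ F u - algebraMap F₀ F w * s) := by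
    simp only [map_sub, map_mul, map_pow]
    linear_combination (algebraMap F₀ F w ^ 2) * hs
  have h2 : algebraMap F₀ F u - algebraMap F₀ F w * s ≠ 0 := by
    rw [e] at h0'; exact right_ne_zero_of_mul h0'
  have h3 : algebraMap F₀ F u + algebraMap F₀ F w * s ≠ 0 := by
    rw [e] at h0'; exact left_ne_zero_of_mul h0'
  refine ⟨h3, ?_⟩
  have h4 := mul_mem (algebraMap_mem_integer_iff (F := F).2 h1')
    (sub_mem (algebraMap_mem_integer_iff (F := F).2 hu)
      (mul_mem (algebraMap_mem_integer_iff (F := F).2 hw) (sqrt_mem_integer hs)))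
  rw [map_inv₀, e, mul_inv, mul_assoc, inv_mul_cancel₀ h2, mul_one] at h4
  exact h4

/-- The extension is unramified with `𝔬_F = 𝔬₀ ⊕ 𝔬₀ √ε`: the coordinates of an integral element
are integral, since otherwise it would be a non-integral multiple of a primitive vector. -/
theorem mem_integer_of_add_mul_mem (hodd : ringChar 𝓀[F₀] ≠ 2) (hε : IsUnit ε)
    (hε' : ¬ IsSquare ε) (hs : s ^ 2 = algebraMap F₀ F ε) {a b : F₀}
    (h : algebraMap F₀ F a + algebraMap F₀ F b * s ∈ 𝒪[F]) : a ∈ 𝒪[F₀] ∧ b ∈ 𝒪[F₀] := by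
  have key : ∀ d : F₀, d ∉ 𝒪[F₀] → a / d ∈ 𝒪[F₀] → b / d ∈ 𝒪[F₀] → (a = d ∨ b = d) → False := by
    intro d hd ha hb hor
    have hd0 : d ≠ 0 := by rintro rfl; exact hd (zero_mem _)
    obtain ⟨h0, h1⟩ := inv_add_mul_mem hodd hε hε' hs ha hb
      (hor.imp (by rintro rfl; exact div_self hd0) (by rintro rfl; exact div_self hd0))
    apply hd
    rw [← algebraMap_mem_integer_iff (F := F)]
    convert mul_mem h h1 using 1
    rw [eq_mul_inv_iff_mul_eq₀ h0]
    have hd1 : algebraMap F₀ F d ≠ 0 := (map_ne_zero_iff _ (algebraMap F₀ F).injective).2 hd0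
    simp only [map_div₀]
    field_simp
  by_contra hn
  rcases eq_or_ne b 0 with rfl | hb0
  · have ha : a ∉ 𝒪[F₀] := fun ha => hn ⟨ha, zero_mem _⟩
    have ha0 : a ≠ 0 := by rintro rfl; exact ha (zero_mem _)
    exact key a ha (by rw [div_self ha0]; exact one_mem _) (by simp) (Or.inl rfl)
  rcases eq_or_ne a 0 with rfl | ha0
  · have hb : b ∉ 𝒪[F₀] := fun hb => hn ⟨zero_mem _, hb⟩
    exact key b hb (by simp) (by rw [div_self hb0]; exact one_mem _) (Or.inr rfl)
  rcases mem_integer_or_inv_mem (a / b) with hq | hq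
  · refine key b (fun hb => hn ⟨?_, hb⟩) hq (by rw [div_self hb0]; exact one_mem _) (Or.inr rfl)
    have := mul_mem hq hb
    rwa [div_mul_cancel₀ _ hb0] at this
  · rw [inv_div] at hq
    refine key a (fun ha => hn ⟨ha, ?_⟩) (by rw [div_self ha0]; exact one_mem _) hq (Or.inl rfl)
    have := mul_mem hq ha
    rwa [div_mul_cancel₀ _ ha0] at this

/-- What the argument uses of an unramified quadratic extension of odd residual characteristic:
`ϖ` is a uniformizer of `F` fixed by the involution `c`, and `s` is a unit with `c s = -s`. -/
structure IsUnramifiedPair (c : F ≃ₐ[F₀] F) (ϖ s : F) : Prop where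
  unif_ne_zero : ϖ ≠ 0
  unif_mem : ϖ ∈ 𝒪[F]
  unif_inv_notMem : ϖ⁻¹ ∉ 𝒪[F]
  conj_unif : c ϖ = ϖ
  conj_conj : ∀ x, c (c x) = x
  conj_mem : ∀ x ∈ 𝒪[F], c x ∈ 𝒪[F]
  unif_dvd_or_inv_mem : ∀ x ∈ 𝒪[F], (∃ y ∈ 𝒪[F], x = ϖ * y) ∨ x⁻¹ ∈ 𝒪[F]
  two_ne_zero : (2 : F) ≠ 0
  inv_two_mem : (2 : F)⁻¹ ∈ 𝒪[F]
  conj_sqrt : c s = -s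
  sqrt_mem : s ∈ 𝒪[F]

theorem isUnramifiedPair (hodd : ringChar 𝓀[F₀] ≠ 2) (hε : IsUnit ε)
    (hε' : ¬ IsSquare ε) (hs : s ^ 2 = algebraMap F₀ F ε) (hF : Algebra.adjoin F₀ {s} = ⊤)
    {c : F ≃ₐ[F₀] F} (hc : c ≠ AlgEquiv.refl) {ϖ : 𝒪[F₀]} (hϖ : Irreducible ϖ) :
    IsUnramifiedPair c (algebraMap F₀ F ϖ) s where
  unif_ne_zero := by
    have : (ϖ : F₀) ≠ 0 := fun h => hϖ.ne_zero (Subtype.ext h)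
    simpa using this
  unif_mem := algebraMap_mem_integer_iff.2 ϖ.2
  unif_inv_notMem := by
    intro h
    rw [← map_inv₀, algebraMap_mem_integer_iff] at h
    exact hϖ.not_isUnit ((isUnit_integer_iff ϖ).2 ⟨fun h => hϖ.ne_zero (Subtype.ext h), h⟩)
  conj_unif := AlgEquiv.commutes _ _
  conj_conj x := by
    obtain ⟨a, b, rfl⟩ := exists_eq_add_mul hs hF x
    simp [conj_sqrt hs hF hc]
  conj_mem x hx := by
    obtain ⟨a, b, rfl⟩ := exists_eq_add_mul hs hF x
    obtain ⟨ha, hb⟩ := mem_integer_of_add_mul_mem hodd hε hε' hs hx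
    simp only [map_add, map_mul, AlgEquiv.commutes, conj_sqrt hs hF hc]
    exact add_mem (algebraMap_mem_integer_iff.2 ha)
      (mul_mem (algebraMap_mem_integer_iff.2 hb) (neg_mem (sqrt_mem_integer hs)))
  unif_dvd_or_inv_mem x hx := by
    obtain ⟨a, b, rfl⟩ := exists_eq_add_mul hs hF x
    obtain ⟨ha, hb⟩ := mem_integer_of_add_mul_mem hodd hε hε' hs hx
    have hdvd : ∀ t : 𝒪[F₀], ¬ IsUnit t → ∃ q : 𝒪[F₀], t = ϖ * q := by
      intro t ht
      have : t ∈ 𝓂[F₀] := (IsLocalRing.mem_maximalIdeal _).2 ht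
      rw [hϖ.maximalIdeal_eq, Ideal.mem_span_singleton] at this
      exact this
    by_cases hau : IsUnit (⟨a, ha⟩ : 𝒪[F₀]) ∨ IsUnit (⟨b, hb⟩ : 𝒪[F₀])
    · right
      obtain ⟨d, hd0, hdi, hor⟩ : ∃ d : F₀, d ≠ 0 ∧ d⁻¹ ∈ 𝒪[F₀] ∧ (a = d ∨ b = d) := by
        rcases hau with h | h
        · obtain ⟨h0, h1⟩ := (isUnit_integer_iff _).1 h
          exact ⟨a, h0, h1, Or.inl rfl⟩
        · obtain ⟨h0, h1⟩ := (isUnit_integer_iff _).1 h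
          exact ⟨b, h0, h1, Or.inr rfl⟩
      obtain ⟨-, h1⟩ := inv_add_mul_mem hodd hε hε' hs (mul_mem hdi ha) (mul_mem hdi hb)
        (hor.imp (by rintro rfl; exact inv_mul_cancel₀ hd0)
          (by rintro rfl; exact inv_mul_cancel₀ hd0))
      have h2 := mul_mem (algebraMap_mem_integer_iff (F := F).2 hdi) h1
      have hd1 : algebraMap F₀ F d ≠ 0 := (map_ne_zero_iff _ (algebraMap F₀ F).injective).2 hd0
      convert h2 using 1
      rw [map_mul, map_mul, map_inv₀, mul_assoc, ← mul_add, mul_inv, inv_inv,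
        inv_mul_cancel_left₀ hd1]
    · left
      push Not at hau
      obtain ⟨q, hq⟩ := hdvd _ hau.1
      obtain ⟨r, hr⟩ := hdvd _ hau.2
      have hq' : a = ϖ * q := congrArg Subtype.val hq
      have hr' : b = ϖ * r := congrArg Subtype.val hr
      refine ⟨algebraMap F₀ F q + algebraMap F₀ F r * s,
        add_mem (algebraMap_mem_integer_iff.2 q.2)
          (mul_mem (algebraMap_mem_integer_iff.2 r.2) (sqrt_mem_integer hs)), ?_⟩
      rw [hq', hr']
      simp only [map_mul]
      ring
  two_ne_zero := by
    have h := ((isUnit_integer_iff _).1 (isUnit_two_integer hodd)).1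
    have h' : (2 : F₀) ≠ 0 := h
    intro h2
    apply h'
    apply (algebraMap F₀ F).injective
    rw [map_zero, map_ofNat, h2]
  inv_two_mem := by
    have h := ((isUnit_integer_iff _).1 (isUnit_two_integer hodd)).2
    have h' : (2 : F₀)⁻¹ ∈ 𝒪[F₀] := h
    have := algebraMap_mem_integer_iff (F := F).2 h'
    rwa [map_inv₀, map_ofNat] at this
  conj_sqrt := conj_sqrt hs hF hc
  sqrt_mem := sqrt_mem_integer hs

end Unramified

/-! ### Fractional ideals, lattice sequences and their filtrations -/


section FractionalIdeals

variable {F₀ F : Type*} [Field F₀] [Field F] [Algebra F₀ F] [ValuativeRel F]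

/-- The fractional ideal `𝔭_F ^ k = ϖ ^ k 𝔬_F`. -/
def fracIdeal (ϖ : F) (k : ℤ) : Submodule 𝒪[F] F where
  carrier := {x | ϖ ^ (-k) * x ∈ 𝒪[F]}
  zero_mem' := by simp
  add_mem' := by
    intro a b ha hb
    simp only [Set.mem_ofPred_eq, mul_add] at *
    exact add_mem ha hb
  smul_mem' := by
    intro r a ha
    have e : ϖ ^ (-k) * (r • a) = r * (ϖ ^ (-k) * a) := by
      rw [Subring.smul_def, smul_eq_mul]; ring
    simp only [Set.mem_ofPred_eq, e] at *
    exact mul_mem r.2 ha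

variable {c : F ≃ₐ[F₀] F} {ϖ s : F}

theorem mem_fracIdeal {k : ℤ} {x : F} : x ∈ fracIdeal ϖ k ↔ ϖ ^ (-k) * x ∈ 𝒪[F] := Iff.rfl

theorem mem_fracIdeal_zero {x : F} : x ∈ fracIdeal ϖ 0 ↔ x ∈ 𝒪[F] := by
  simp [mem_fracIdeal]

theorem IsUnramifiedPair.mem_iff (h : IsUnramifiedPair c ϖ s) {k : ℤ} {x : F} :
    x ∈ fracIdeal ϖ k ↔ ∃ y ∈ 𝒪[F], x = ϖ ^ k * y := by
  have h0 := zpow_ne_zero k h.unif_ne_zero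
  constructor
  · intro hx
    refine ⟨_, hx, ?_⟩
    rw [zpow_neg, mul_inv_cancel_left₀ h0]
  · rintro ⟨y, hy, rfl⟩
    rw [mem_fracIdeal, zpow_neg, inv_mul_cancel_left₀ h0]
    exact hy

theorem IsUnramifiedPair.mul_mem (h : IsUnramifiedPair c ϖ s) {k l : ℤ} {x y : F}
    (hx : x ∈ fracIdeal ϖ k) (hy : y ∈ fracIdeal ϖ l) : x * y ∈ fracIdeal ϖ (k + l) := by
  have e : ϖ ^ (-(k + l)) * (x * y) = (ϖ ^ (-k) * x) * (ϖ ^ (-l) * y) := by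
    rw [neg_add, zpow_add₀ h.unif_ne_zero]; ring
  rw [mem_fracIdeal, e]
  exact MulMemClass.mul_mem hx hy

theorem IsUnramifiedPair.mono (h : IsUnramifiedPair c ϖ s) {k l : ℤ} (hkl : l ≤ k) {x : F}
    (hx : x ∈ fracIdeal ϖ k) : x ∈ fracIdeal ϖ l := by
  obtain ⟨n, rfl⟩ := Int.le.dest hkl
  have e : ϖ ^ (-l) * x = ϖ ^ n * (ϖ ^ (-(l + n)) * x) := by
    rw [neg_add, zpow_add₀ h.unif_ne_zero, zpow_neg ϖ n, zpow_natCast]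
    have := pow_ne_zero n h.unif_ne_zero
    field_simp
  rw [mem_fracIdeal, e]
  exact MulMemClass.mul_mem (pow_mem h.unif_mem n) hx

theorem IsUnramifiedPair.mul_mem_of_le (h : IsUnramifiedPair c ϖ s) {k l m : ℤ} {x y : F}
    (hx : x ∈ fracIdeal ϖ k) (hy : y ∈ fracIdeal ϖ l) (hm : m ≤ k + l) :
    x * y ∈ fracIdeal ϖ m :=
  h.mono hm (h.mul_mem hx hy)

theorem IsUnramifiedPair.zpow_mem (h : IsUnramifiedPair c ϖ s) (k : ℤ) :
    ϖ ^ k ∈ fracIdeal ϖ k := by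
  rw [mem_fracIdeal, ← zpow_add₀ h.unif_ne_zero, neg_add_cancel, zpow_zero]
  exact one_mem _

theorem IsUnramifiedPair.zpow_mul_mem_iff (h : IsUnramifiedPair c ϖ s) {i k : ℤ} {x : F} :
    ϖ ^ i * x ∈ fracIdeal ϖ k ↔ x ∈ fracIdeal ϖ (k - i) := by
  rw [mem_fracIdeal, mem_fracIdeal, ← mul_assoc, ← zpow_add₀ h.unif_ne_zero]
  ring_nf

theorem IsUnramifiedPair.conj_mem_fracIdeal (h : IsUnramifiedPair c ϖ s) {k : ℤ} {x : F}
    (hx : x ∈ fracIdeal ϖ k) : c x ∈ fracIdeal ϖ k := by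
  have := h.conj_mem _ hx
  rwa [map_mul, map_zpow₀, h.conj_unif] at this

theorem IsUnramifiedPair.inv_mem_of_notMem (h : IsUnramifiedPair c ϖ s) {x : F} (hx : x ∈ 𝒪[F])
    (hx' : x ∉ fracIdeal ϖ 1) : x ≠ 0 ∧ x⁻¹ ∈ 𝒪[F] := by
  refine ⟨by rintro rfl; exact hx' (zero_mem _), ?_⟩
  rcases h.unif_dvd_or_inv_mem x hx with ⟨y, hy, rfl⟩ | h1
  · exact absurd (h.mem_iff.2 ⟨y, hy, by simp⟩) hx'
  · exact h1

theorem IsUnramifiedPair.notMem_of_inv_mem (h : IsUnramifiedPair c ϖ s) {x : F} (hx0 : x ≠ 0)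
    (hx : x⁻¹ ∈ 𝒪[F]) : x ∉ fracIdeal ϖ 1 := by
  intro h1
  apply h.unif_inv_notMem
  have := MulMemClass.mul_mem (s := 𝒪[F]) h1 hx
  simpa [hx0] using this

/-- The maximal ideal of `𝔬_F` is generated by `ϖ`. -/
theorem IsUnramifiedPair.residue_eq_zero_iff (h : IsUnramifiedPair c ϖ s) (x : 𝒪[F]) :
    IsLocalRing.residue 𝒪[F] x = 0 ↔ (x : F) ∈ fracIdeal ϖ 1 := by
  rw [IsLocalRing.residue_eq_zero_iff, IsLocalRing.mem_maximalIdeal, mem_nonunits_iff,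
    isUnit_integer_iff]
  constructor
  · intro hx
    by_contra h1
    exact hx (h.inv_mem_of_notMem x.2 h1)
  · rintro hx ⟨h0, h1⟩
    exact h.notMem_of_inv_mem h0 h1 hx

end FractionalIdeals

section HermitianForm

variable {F₀ F : Type*} [Field F₀] [Field F] [Algebra F₀ F] {c : F ≃ₐ[F₀] F}

theorem form_eq (x y : Fin 4 → F) :
    form c x y = c (x 0) * y 3 + c (x 1) * y 2 + c (x 2) * y 1 + c (x 3) * y 0 := by
  simp [form, formMatrix, Matrix.mulVec, dotProduct, Fin.sum_univ_four]

theorem form_eq_sum (x y : Fin 4 → F) : form c x y = ∑ j, c (x j) * y j.rev := by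
  rw [form_eq, Fin.sum_univ_four]; rfl

theorem sigma_apply (X : Matrix (Fin 4) (Fin 4) F) (i j : Fin 4) :
    sigma c X i j = c (X j.rev i.rev) := by
  fin_cases i <;> fin_cases j <;>
    simp [sigma, formMatrix, Matrix.mul_apply, Matrix.vecMul, dotProduct, Fin.sum_univ_four,
      Fin.rev]

end HermitianForm

section LatticeSequences

variable {F₀ F : Type*} [Field F₀] [Field F] [Algebra F₀ F] [ValuativeRel F]

/-- The lattice `𝔭^{a₁} e₁ ⊕ ⋯ ⊕ 𝔭^{a₄} e₄`. -/
noncomputable def boxLattice (ϖ : F) (a : Fin 4 → ℤ) : Submodule 𝒪[F] (Fin 4 → F) :=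
  Submodule.pi Set.univ fun j => fracIdeal ϖ (a j)

/-- The lattice sequence of period two attached to `d`: the exponent of its `i`-th lattice
at the `j`-th coordinate is `⌊(i + d_j) / 2⌋`. -/
noncomputable def latSeq (ϖ : F) (d : Fin 4 → ℤ) (i : ℤ) : Submodule 𝒪[F] (Fin 4 → F) :=
  boxLattice ϖ fun j => (i + d j) / 2

variable {c : F ≃ₐ[F₀] F} {ϖ s : F}

theorem mem_boxLattice {a : Fin 4 → ℤ} {v : Fin 4 → F} :
    v ∈ boxLattice ϖ a ↔ ∀ j, v j ∈ fracIdeal ϖ (a j) := by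
  simp [boxLattice, Submodule.mem_pi]

theorem mem_latSeq {d : Fin 4 → ℤ} {i : ℤ} {v : Fin 4 → F} :
    v ∈ latSeq ϖ d i ↔ ∀ j, v j ∈ fracIdeal ϖ ((i + d j) / 2) :=
  mem_boxLattice

theorem N_eq_boxLattice (h : IsUnramifiedPair c ϖ s) (k : ℕ) :
    N F k = boxLattice ϖ fun j => if (j : ℕ) + k < 4 then 0 else 1 := by
  rw [N, boxLattice]
  congr 1
  funext j
  split_ifs with hj
  · ext x
    rw [mem_fracIdeal_zero]
    constructor
    · rintro ⟨y, rfl⟩; exact y.2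
    · intro hx; exact ⟨⟨x, hx⟩, rfl⟩
  · ext x
    constructor
    · rintro ⟨y, hy, rfl⟩
      exact (h.residue_eq_zero_iff y).1 ((IsLocalRing.residue_eq_zero_iff y).2 hy)
    · intro hx
      have hx' : x ∈ 𝒪[F] := mem_fracIdeal_zero.1 (h.mono zero_le_one hx)
      exact ⟨⟨x, hx'⟩, (IsLocalRing.residue_eq_zero_iff (⟨x, hx'⟩ : 𝒪[F])).1
        ((h.residue_eq_zero_iff _).2 hx), rfl⟩

theorem zpow_smul_boxLattice (h : IsUnramifiedPair c ϖ s) (k : ℤ) (a : Fin 4 → ℤ) :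
    ϖ ^ k • boxLattice ϖ a = boxLattice ϖ fun j => a j + k := by
  ext v
  rw [Submodule.mem_smul_pointwise_iff_exists, mem_boxLattice]
  constructor
  · rintro ⟨w, hw, rfl⟩ j
    rw [Pi.smul_apply, smul_eq_mul, h.zpow_mul_mem_iff]
    simpa using mem_boxLattice.1 hw j
  · intro hv
    refine ⟨ϖ ^ (-k) • v, mem_boxLattice.2 fun j => ?_, ?_⟩
    · rw [Pi.smul_apply, smul_eq_mul, h.zpow_mul_mem_iff]
      simpa using hv j
    · rw [smul_smul, ← zpow_add₀ h.unif_ne_zero, add_neg_cancel, zpow_zero, one_smul]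

theorem dual_boxLattice (h : IsUnramifiedPair c ϖ s) (a : Fin 4 → ℤ) :
    dual c (boxLattice ϖ a) = boxLattice ϖ fun j => -a j.rev := by
  ext v
  rw [mem_boxLattice]
  constructor
  · intro hv j
    have h1 := hv (Pi.single j.rev (ϖ ^ a j.rev)) (mem_boxLattice.2 fun i => by
      by_cases hi : i = j.rev
      · subst hi; simpa using h.zpow_mem _
      · simp [hi])
    rw [form_eq_sum, Finset.sum_eq_single j.rev] at h1
    · rw [Pi.single_eq_same, map_zpow₀, h.conj_unif, Fin.rev_rev] at h1
      rw [mem_fracIdeal, neg_neg]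
      exact h1
    · intro i _ hi
      simp [hi]
    · simp
  · intro hv w hw
    rw [form_eq_sum]
    refine sum_mem fun j _ => ?_
    rw [← mem_fracIdeal_zero (ϖ := ϖ)]
    refine h.mul_mem_of_le (h.conj_mem_fracIdeal (mem_boxLattice.1 hw j)) (hv j.rev) ?_
    simp

/-- The exponents of the lattice sequence through `N₀` and `N₂`. -/
def expN02 : Fin 4 → ℤ := ![0, 0, 1, 1]

/-- The exponents of the lattice sequence through `N₁` and its dual. -/
def expN1 : Fin 4 → ℤ := ![0, 1, 1, 2]

theorem seqN0N2_eq (h : IsUnramifiedPair c ϖ s) : seqN0N2 ϖ = latSeq ϖ expN02 := by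
  funext i
  rw [seqN0N2, N_eq_boxLattice h, N_eq_boxLattice h, zpow_smul_boxLattice h,
    zpow_smul_boxLattice h, latSeq]
  split_ifs with hi
  · congr 1; funext j
    have := Int.even_iff.1 hi
    fin_cases j <;> simp [expN02] <;> omega
  · congr 1; funext j
    have := Int.not_even_iff.1 hi
    fin_cases j <;> simp [expN02] <;> omega

theorem seqN1_eq (h : IsUnramifiedPair c ϖ s) : seqN1 c ϖ = latSeq ϖ expN1 := by
  funext i
  rw [seqN1, N_eq_boxLattice h, dual_boxLattice h, zpow_smul_boxLattice h,
    zpow_smul_boxLattice h, latSeq]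
  split_ifs with hi
  · congr 1; funext j
    have := Int.even_iff.1 hi
    fin_cases j <;> simp [expN1] <;> omega
  · congr 1; funext j
    have := Int.not_even_iff.1 hi
    fin_cases j <;> simp [expN1, Fin.rev] <;> omega

theorem boxLattice_eq_span (h : IsUnramifiedPair c ϖ s) (a : Fin 4 → ℤ) :
    boxLattice ϖ a =
      Submodule.span 𝒪[F] (Set.range fun j : Fin 4 => (Pi.single j (ϖ ^ a j) : Fin 4 → F)) := by
  apply le_antisymm
  · intro v hv
    rw [mem_boxLattice] at hv
    have e : v = ∑ j, (⟨_, mem_fracIdeal.1 (hv j)⟩ : 𝒪[F]) •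
        (Pi.single j (ϖ ^ a j) : Fin 4 → F) := by
      funext i
      rw [Finset.sum_apply, Finset.sum_eq_single i]
      · rw [Pi.smul_apply, Subring.smul_def, Pi.single_eq_same, smul_eq_mul]
        change v i = ϖ ^ (-a i) * v i * ϖ ^ a i
        rw [zpow_neg, mul_right_comm, inv_mul_cancel₀ (zpow_ne_zero _ h.unif_ne_zero), one_mul]
      · intro j _ hj
        simp [Ne.symm hj]
      · simp
    rw [e]
    exact sum_mem fun j _ => Submodule.smul_mem _ _ (Submodule.subset_span ⟨j, rfl⟩)
  · rw [Submodule.span_le]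
    rintro _ ⟨j, rfl⟩
    refine mem_boxLattice.2 fun i => ?_
    by_cases hi : i = j
    · subst hi; simpa using h.zpow_mem _
    · simp [hi]

theorem latSeq_isLatticeSequence (h : IsUnramifiedPair c ϖ s) (d : Fin 4 → ℤ) :
    IsLatticeSequence ϖ (latSeq ϖ d) 2 where
  fg i := by
    rw [latSeq, boxLattice_eq_span h]
    exact Submodule.fg_span (Set.finite_range _)
  span_eq_top i := by
    rw [eq_top_iff]
    intro v _
    have e : v = ∑ j, (v j * ϖ ^ (-((i + d j) / 2))) •
        (Pi.single j (ϖ ^ ((i + d j) / 2)) : Fin 4 → F) := by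
      funext k
      rw [Finset.sum_apply, Finset.sum_eq_single k]
      · rw [Pi.smul_apply, Pi.single_eq_same, smul_eq_mul, zpow_neg,
          inv_mul_cancel_right₀ (zpow_ne_zero _ h.unif_ne_zero)]
      · intro j _ hj
        simp [Ne.symm hj]
      · simp
    rw [e]
    refine sum_mem fun j _ => Submodule.smul_mem _ _ (Submodule.subset_span ?_)
    rw [SetLike.mem_coe, latSeq, boxLattice_eq_span h]
    exact Submodule.subset_span ⟨j, rfl⟩
  antitone i v hv := by
    rw [mem_latSeq] at *
    exact fun j => h.mono (by omega) (hv j)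
  period i := by
    have := zpow_smul_boxLattice h 1 fun j => (i + d j) / 2
    rw [zpow_one] at this
    rw [latSeq, this, latSeq]
    congr 1
    funext j
    push_cast
    omega

theorem latSeq_isSelfDual (h : IsUnramifiedPair c ϖ s) {d : Fin 4 → ℤ} {t : ℤ}
    (hd : ∀ j, d j + d j.rev = t) : IsSelfDual c (latSeq ϖ d) := by
  refine ⟨1 - t, fun i => ?_⟩
  rw [latSeq, dual_boxLattice h, latSeq]
  congr 1
  funext j
  have := hd j
  omega

/-- Membership in `𝔞_k` is a condition on the valuations of the matrix entries. -/
theorem mem_filtration_latSeq (h : IsUnramifiedPair c ϖ s) {d : Fin 4 → ℤ} {k : ℤ}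
    {X : Matrix (Fin 4) (Fin 4) F} :
    X ∈ filtration (latSeq ϖ d) k ↔ ∀ i j, X i j ∈ fracIdeal ϖ ((k + d i - d j + 1) / 2) := by
  constructor
  · intro hX i j
    -- The vector `e_j` lies in the lattice of index `1 - d j`, which gives the sharpest bound.
    have h1 := hX (1 - d j) (Pi.single j 1) (mem_latSeq.2 fun l => by
      by_cases hl : l = j
      · subst hl
        rw [Pi.single_eq_same]
        have e : (1 - d l + d l) / 2 = 0 := by omega
        rw [e]
        exact mem_fracIdeal_zero.2 (one_mem _)
      · simp [hl])
    have h2 := mem_latSeq.1 h1 i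
    rw [Matrix.mulVec_single_one, Matrix.col_apply] at h2
    exact h.mono (by omega) h2
  · intro hX t v hv
    rw [mem_latSeq] at *
    intro i
    rw [Matrix.mulVec, dotProduct]
    exact sum_mem fun j _ => h.mul_mem_of_le (hX i j) (hv j) (by omega)

theorem mul_mem_filtration {Λ : ℤ → Submodule 𝒪[F] (Fin 4 → F)} {k l : ℤ}
    {X Y : Matrix (Fin 4) (Fin 4) F} (hX : X ∈ filtration Λ k) (hY : Y ∈ filtration Λ l) :
    X * Y ∈ filtration Λ (k + l) := by
  intro i v hv
  rw [← Matrix.mulVec_mulVec, add_comm k l, ← add_assoc]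
  exact hX _ _ (hY _ _ hv)

theorem add_mem_filtration {Λ : ℤ → Submodule 𝒪[F] (Fin 4 → F)} {k : ℤ}
    {X Y : Matrix (Fin 4) (Fin 4) F} (hX : X ∈ filtration Λ k) (hY : Y ∈ filtration Λ k) :
    X + Y ∈ filtration Λ k := by
  intro i v hv
  rw [Matrix.add_mulVec]
  exact add_mem (hX _ _ hv) (hY _ _ hv)

theorem filtration_latSeq_mono (h : IsUnramifiedPair c ϖ s) {d : Fin 4 → ℤ} {k l : ℤ}
    (hkl : l ≤ k) {X : Matrix (Fin 4) (Fin 4) F} (hX : X ∈ filtration (latSeq ϖ d) k) :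
    X ∈ filtration (latSeq ϖ d) l := by
  rw [mem_filtration_latSeq h] at *
  exact fun i j => h.mono (by omega) (hX i j)

theorem sigma_mem_filtration (h : IsUnramifiedPair c ϖ s) {d : Fin 4 → ℤ} {t : ℤ}
    (hd : ∀ j, d j + d j.rev = t) {k : ℤ} {X : Matrix (Fin 4) (Fin 4) F}
    (hX : X ∈ filtration (latSeq ϖ d) k) : sigma c X ∈ filtration (latSeq ϖ d) k := by
  rw [mem_filtration_latSeq h] at *
  intro i j
  rw [sigma_apply]
  refine h.conj_mem_fracIdeal (h.mono (le_of_eq ?_) (hX j.rev i.rev))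
  have h1 := hd i
  have h2 := hd j
  congr 1
  omega

end LatticeSequences

/-! ### Additive characters and projection to an eigenvector -/


section ResidueCharacter

variable {K : Type*} [Field K] [ValuativeRel K]

/-- A lift of an element of the residue field to the ring of integers. -/
noncomputable def residueLift (b : 𝓀[K]) : 𝒪[K] :=
  Function.surjInv IsLocalRing.residue_surjective b

theorem residue_residueLift (b : 𝓀[K]) :
    IsLocalRing.residue 𝒪[K] (residueLift b) = b :=
  Function.surjInv_eq _ b

theorem apply_eq_of_residue_eq {Ω : AddChar K Circle} (hΩ : HasConductorPrime Ω) {x y : 𝒪[K]}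
    (hxy : IsLocalRing.residue 𝒪[K] x = IsLocalRing.residue 𝒪[K] y) : Ω x = Ω y := by
  have h1 : x - y ∈ 𝓂[K] := by
    rw [← IsLocalRing.residue_eq_zero_iff, map_sub, hxy, sub_self]
  have e : (x : K) = (x - y : 𝒪[K]) + y := by simp
  rw [e, AddChar.map_add_eq_mul, hΩ.1 _ h1, one_mul]

/-- The additive character of the residue field induced by a character of conductor `𝔭₀`. -/
noncomputable def residueChar {Ω : AddChar K Circle} (hΩ : HasConductorPrime Ω) :
    AddChar 𝓀[K] ℂ where
  toFun b := Ω (residueLift b)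
  map_zero_eq_one' := by
    have := apply_eq_of_residue_eq hΩ (x := residueLift 0) (y := 0) (by
      rw [residue_residueLift, map_zero])
    rw [this]
    simp
  map_add_eq_mul' a b := by
    have := apply_eq_of_residue_eq hΩ (x := residueLift (a + b)) (y := residueLift a + residueLift b)
      (by rw [map_add]; simp only [residue_residueLift])
    rw [this, Subring.coe_add, AddChar.map_add_eq_mul, Circle.coe_mul]

theorem sum_apply_residueLift_mul [Fintype 𝓀[K]] {Ω : AddChar K Circle}
    (hΩ : HasConductorPrime Ω) {t : 𝒪[K]} (ht : IsUnit t) :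
    ∑ b : 𝓀[K], (Ω (residueLift b * t : 𝒪[K]) : ℂ) = 0 := by
  have h1 : ∀ b : 𝓀[K], (Ω (residueLift b * t : 𝒪[K]) : ℂ)
      = residueChar hΩ (b * IsLocalRing.residue 𝒪[K] t) := by
    intro b
    change _ = ((Ω _ : Circle) : ℂ)
    rw [apply_eq_of_residue_eq hΩ (y := residueLift (b * IsLocalRing.residue 𝒪[K] t))]
    rw [map_mul]
    simp only [residue_residueLift]
  have ht' : IsLocalRing.residue 𝒪[K] t ≠ 0 := (IsLocalRing.residue_ne_zero_iff_isUnit t).2 ht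
  rw [Finset.sum_congr rfl fun b _ => h1 b]
  rw [Fintype.sum_equiv (Equiv.mulRight₀ _ ht')
    (fun b => residueChar hΩ (b * IsLocalRing.residue 𝒪[K] t)) (fun b => residueChar hΩ b)
    fun b => rfl]
  apply AddChar.sum_eq_zero_of_ne_one
  obtain ⟨x, hx⟩ := hΩ.2
  intro h
  apply hx
  have h2 : residueChar hΩ (IsLocalRing.residue 𝒪[K] x) = 1 := by rw [h]; rfl
  have h3 : ((Ω (residueLift (IsLocalRing.residue 𝒪[K] x)) : Circle) : ℂ) = 1 := h2
  rw [apply_eq_of_residue_eq hΩ (y := x) (residue_residueLift _)] at h3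
  exact Circle.ext h3

end ResidueCharacter

section TraceCharacter

variable {F₀ F : Type*} [Field F₀] [Field F] [Algebra F₀ F]

/-- The additive character `Ω ∘ tr_{F/F₀}` of `F`. -/
noncomputable def traceChar (F : Type*) [Field F] [Algebra F₀ F] (Ω : AddChar F₀ Circle) :
    AddChar F Circle :=
  Ω.compAddMonoidHom (Algebra.trace F₀ F).toAddMonoidHom

theorem traceChar_apply (Ω : AddChar F₀ Circle) (x : F) :
    traceChar F Ω x = Ω (Algebra.trace F₀ F x) := rfl

theorem psi_eq {c : F ≃ₐ[F₀] F} (Ω : AddChar F₀ Circle) (β : Matrix (Fin 4) (Fin 4) F)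
    (p : U22 c) :
    psi c Ω β p = (traceChar F Ω
      (β * (((p : GL (Fin 4) F) : Matrix (Fin 4) (Fin 4) F) - 1)).trace : ℂ) := rfl

variable [ValuativeRel F₀] [ValuativeRel F] {c : F ≃ₐ[F₀] F} {ϖ : 𝒪[F₀]} {s : F} {ε : 𝒪[F₀]}

theorem trace_add_mul (h : IsUnramifiedPair c (algebraMap F₀ F ϖ) s)
    (hs : s ^ 2 = algebraMap F₀ F ε) (hF : Algebra.adjoin F₀ {s} = ⊤) (hs0 : s ≠ 0)
    (a b : F₀) : Algebra.trace F₀ F (algebraMap F₀ F a + algebraMap F₀ F b * s) = 2 * a := by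
  have h2 : (2 : F₀) ≠ 0 := by
    intro h2
    apply h.two_ne_zero
    rw [← map_ofNat (algebraMap F₀ F), h2, map_zero]
  have hli : LinearIndependent F₀ ![(1 : F), s] := by
    rw [LinearIndependent.pair_iff]
    intro x y hxy
    have hc := congrArg c hxy
    simp only [Algebra.smul_def, mul_one, map_add, map_mul, AlgEquiv.commutes, h.conj_sqrt,
      map_zero] at hxy hc
    have hx : 2 * algebraMap F₀ F x = 0 := by linear_combination hxy + hc
    have hy : 2 * (algebraMap F₀ F y * s) = 0 := by linear_combination hxy - hc
    constructor
    · simpa [h.two_ne_zero] using hx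
    · simpa [h.two_ne_zero, hs0] using hy
  have hfin : Module.finrank F₀ F = 2 := by
    have hsp : ⊤ ≤ Submodule.span F₀ (Set.range ![(1 : F), s]) := by
      intro x _
      obtain ⟨a, b, rfl⟩ := exists_eq_add_mul hs hF x
      rw [Matrix.range_cons_cons_empty, Submodule.mem_span_pair]
      exact ⟨a, b, by simp [Algebra.smul_def]⟩
    rw [Module.finrank_eq_card_basis (Module.Basis.mk hli hsp)]
    simp
  have htr : Algebra.trace F₀ F (algebraMap F₀ F b * s) = 0 := by
    have e := Algebra.trace_eq_of_algEquiv c (algebraMap F₀ F b * s)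
    rw [map_mul, AlgEquiv.commutes, h.conj_sqrt, mul_neg, map_neg] at e
    have : 2 * Algebra.trace F₀ F (algebraMap F₀ F b * s) = 0 := by linear_combination -e
    simpa [h2] using this
  rw [map_add, htr, add_zero, Algebra.trace_algebraMap, hfin, nsmul_eq_mul]
  norm_num

variable [TopologicalSpace F₀] [IsNonarchimedeanLocalField F₀]

theorem mul_mem_maximalIdeal (hϖ : Irreducible ϖ) (x : 𝒪[F₀]) : ϖ * x ∈ 𝓂[F₀] := by
  rw [hϖ.maximalIdeal_eq]
  exact Ideal.mul_mem_right _ _ (Ideal.mem_span_singleton_self ϖ)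

variable [ValuativeExtension F₀ F]

theorem traceChar_eq_one (hodd : ringChar 𝓀[F₀] ≠ 2) (hε : IsUnit ε)
    (hε' : ¬ IsSquare ε) (hs : s ^ 2 = algebraMap F₀ F ε) (hF : Algebra.adjoin F₀ {s} = ⊤)
    (hc : c ≠ AlgEquiv.refl) (hϖ : Irreducible ϖ)
    {Ω : AddChar F₀ Circle} (hΩ : HasConductorPrime Ω) {x : F}
    (hx : x ∈ fracIdeal (algebraMap F₀ F ϖ) 1) : traceChar F Ω x = 1 := by
  have h := isUnramifiedPair hodd hε hε' hs hF hc hϖ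
  have hs0 : s ≠ 0 := by
    rintro rfl
    have : algebraMap F₀ F ε = 0 := by rw [← hs]; simp
    exact ((isUnit_integer_iff ε).1 hε).1 (by simpa using this)
  obtain ⟨y, hy, rfl⟩ := h.mem_iff.1 hx
  obtain ⟨a, b, rfl⟩ := exists_eq_add_mul hs hF y
  obtain ⟨ha, -⟩ := mem_integer_of_add_mul_mem hodd hε hε' hs hy
  have e : algebraMap F₀ F ϖ ^ (1 : ℤ) * (algebraMap F₀ F a + algebraMap F₀ F b * s)
      = algebraMap F₀ F (ϖ * a) + algebraMap F₀ F (ϖ * b) * s := by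
    simp only [map_mul, zpow_one]; ring
  rw [traceChar_apply, e, trace_add_mul h hs hF hs0]
  have := hΩ.1 _ (mul_mem_maximalIdeal hϖ (2 * ⟨a, ha⟩))
  rw [← this]
  congr 1
  simp only [Subring.coe_mul]
  have : (((2 : 𝒪[F₀]) : 𝒪[F₀]) : F₀) = 2 := rfl
  rw [this]
  ring

/-- Orthogonality: a unit `z` which is antisymmetric modulo `𝔭_F` pairs nontrivially with the
antisymmetric elements `b √ε`. -/
theorem sum_traceChar_eq_zero (hodd : ringChar 𝓀[F₀] ≠ 2) (hε : IsUnit ε)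
    (hε' : ¬ IsSquare ε) (hs : s ^ 2 = algebraMap F₀ F ε) (hF : Algebra.adjoin F₀ {s} = ⊤)
    (hc : c ≠ AlgEquiv.refl) (hϖ : Irreducible ϖ) [Fintype 𝓀[F₀]]
    {Ω : AddChar F₀ Circle} (hΩ : HasConductorPrime Ω) {z : F} (hz : z ∈ 𝒪[F])
    (hz1 : z ∉ fracIdeal (algebraMap F₀ F ϖ) 1)
    (hz2 : z + c z ∈ fracIdeal (algebraMap F₀ F ϖ) 1) :
    ∑ b : 𝓀[F₀], (traceChar F Ω (algebraMap F₀ F (residueLift b) * s * z) : ℂ) = 0 := by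
  have h := isUnramifiedPair hodd hε hε' hs hF hc hϖ
  have hs0 : s ≠ 0 := by
    rintro rfl
    have : algebraMap F₀ F ε = 0 := by rw [← hs]; simp
    exact ((isUnit_integer_iff ε).1 hε).1 (by simpa using this)
  obtain ⟨a, b, rfl⟩ := exists_eq_add_mul hs hF z
  obtain ⟨ha, hb⟩ := mem_integer_of_add_mul_mem hodd hε hε' hs hz
  have hbu : IsUnit (⟨b, hb⟩ : 𝒪[F₀]) := by
    by_contra hn
    have hm : (⟨b, hb⟩ : 𝒪[F₀]) ∈ 𝓂[F₀] := (IsLocalRing.mem_maximalIdeal _).2 hn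
    rw [hϖ.maximalIdeal_eq, Ideal.mem_span_singleton] at hm
    obtain ⟨q, hq⟩ := hm
    have hq' : b = ϖ * q := congrArg Subtype.val hq
    apply hz1
    refine add_mem ?_ ?_
    · have e : algebraMap F₀ F a = (2 : F)⁻¹ * (algebraMap F₀ F a + algebraMap F₀ F b * s +
          c (algebraMap F₀ F a + algebraMap F₀ F b * s)) := by
        have := h.two_ne_zero
        simp only [map_add, map_mul, AlgEquiv.commutes, h.conj_sqrt]
        field_simp
        ring
      rw [e]
      exact h.mul_mem_of_le (mem_fracIdeal_zero.2 h.inv_two_mem) hz2 (by norm_num)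
    · refine h.mul_mem_of_le (k := 1) (l := 0) ?_ (mem_fracIdeal_zero.2 h.sqrt_mem) (by norm_num)
      refine h.mem_iff.2 ⟨algebraMap F₀ F q, algebraMap_mem_integer_iff.2 q.2, ?_⟩
      rw [hq', map_mul, zpow_one]
  have ht : IsUnit (2 * ⟨b, hb⟩ * ε : 𝒪[F₀]) := ((isUnit_two_integer hodd).mul hbu).mul hε
  rw [← sum_apply_residueLift_mul hΩ ht]
  refine Finset.sum_congr rfl fun x _ => ?_
  have e : algebraMap F₀ F (residueLift x) * s * (algebraMap F₀ F a + algebraMap F₀ F b * s)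
      = algebraMap F₀ F (residueLift x * b * ε) + algebraMap F₀ F (residueLift x * a) * s := by
    simp only [map_mul]
    linear_combination (algebraMap F₀ F (residueLift x) * algebraMap F₀ F b) * hs
  rw [traceChar_apply, e, trace_add_mul h hs hF hs0]
  congr 2
  simp only [Subring.coe_mul]
  have : (((2 : 𝒪[F₀]) : 𝒪[F₀]) : F₀) = 2 := rfl
  rw [this]
  ring

end TraceCharacter

section Projection

variable {G W : Type*} [Group G] [AddCommGroup W] [Module ℂ W]

/-- If a finite-index subgroup `K` acts on `w` through the restriction of each member of a finite
family `χ` of characters of `G`, and `∑ χ_b` vanishes off `K`, then some `χ_b` occurs in the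
representation: the `χ_b`-projections of `w` over `G / K` add up to a multiple of `w`. -/
theorem exists_eigenvector_of_sum_eq_zero (π : Representation ℂ G W) (K : Subgroup G)
    [K.FiniteIndex] {B : Type*} [Fintype B] [Nonempty B] (χ : B → G →* ℂ) {w : W} (hw : w ≠ 0)
    (hK : ∀ b, ∀ k ∈ K, π k w = χ b k • w) (hsum : ∀ g, g ∉ K → ∑ b, χ b g = 0) :
    ∃ b, ∃ w' : W, w' ≠ 0 ∧ ∀ g, π g w' = χ b g • w' := by
  have := Fintype.ofFinite (G ⧸ K)
  let f : B → G → W := fun b g => χ b g⁻¹ • π g w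
  have hinv : ∀ (b : B) (g : G), χ b g⁻¹ * χ b g = 1 := fun b g => by rw [← map_mul]; simp
  have hf : ∀ (b : B) (g k : G), k ∈ K → f b (g * k) = f b g := by
    intro b g k hk
    simp only [f, map_mul, mul_inv_rev, Module.End.mul_apply, hK b k hk, map_smul, smul_smul]
    congr 1
    rw [mul_right_comm, hinv, one_mul]
  have hout : ∀ (b : B) (g : G), f b (Quotient.out (g : G ⧸ K)) = f b g := by
    intro b g
    obtain ⟨k, hk⟩ := QuotientGroup.mk_out_eq_mul K g
    rw [hk, hf b g k k.2]
  let v : B → W := fun b => ∑ q : G ⧸ K, f b q.out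
  have hact : ∀ b g, π g (v b) = χ b g • v b := by
    intro b g
    simp only [v, map_sum, Finset.smul_sum]
    refine Fintype.sum_equiv (MulAction.toPerm g) _ _ fun q => ?_
    have e : (MulAction.toPerm g) q = ((g * q.out : G) : G ⧸ K) := by
      conv_lhs => rw [← QuotientGroup.out_eq' q]
      rfl
    rw [e, hout]
    simp only [f, mul_inv_rev, map_mul, Module.End.mul_apply, map_smul, smul_smul]
    congr 1
    rw [mul_comm (χ b g), mul_assoc, hinv, mul_one]
  have hne : ∑ b, v b ≠ 0 := by
    simp only [v]
    rw [Finset.sum_comm, Finset.sum_eq_single ((1 : G) : G ⧸ K)]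
    · simp only [hout]
      simp only [f, inv_one, map_one, one_smul, Module.End.one_apply, Finset.sum_const,
        Finset.card_univ]
      rw [← Nat.cast_smul_eq_nsmul ℂ]
      exact smul_ne_zero (Nat.cast_ne_zero.2 Fintype.card_ne_zero) hw
    · intro q _ hq
      simp only [f]
      rw [← Finset.sum_smul, hsum, zero_smul]
      intro hmem
      apply hq
      rw [← QuotientGroup.out_eq' q, QuotientGroup.eq]
      simpa using hmem
    · simp
  obtain ⟨b, -, hb⟩ := Finset.exists_ne_zero_of_sum_ne_zero hne
  exact ⟨b, v b, hb, hact b⟩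

end Projection

/-! ### Congruence subgroups and the characters `ψ_β` -/


section CongruenceSubgroups

variable {F₀ F : Type*} [Field F₀] [Field F] [Algebra F₀ F]

theorem sigma_add (c : F ≃ₐ[F₀] F) (X Y : Matrix (Fin 4) (Fin 4) F) :
    sigma c (X + Y) = sigma c X + sigma c Y := by
  ext i j
  simp [sigma_apply]

theorem sigma_sub (c : F ≃ₐ[F₀] F) (X Y : Matrix (Fin 4) (Fin 4) F) :
    sigma c (X - Y) = sigma c X - sigma c Y := by
  ext i j
  simp [sigma_apply]

theorem sigma_single (c : F ≃ₐ[F₀] F) (i j : Fin 4) (x : F) :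
    sigma c (Matrix.single i j x) = Matrix.single j.rev i.rev (c x) := by
  ext k l
  rw [sigma_apply, Matrix.single_apply, Matrix.single_apply]
  have e : (i = l.rev ∧ j = k.rev) ↔ (j.rev = k ∧ i.rev = l) := by
    rw [Fin.rev_eq_iff, Fin.rev_eq_iff, and_comm]
  simp only [e]
  split_ifs <;> simp

theorem mem_lieG_iff {c : F ≃ₐ[F₀] F} {X : Matrix (Fin 4) (Fin 4) F} :
    X ∈ lieG c ↔ ∀ i j, X i j = -c (X j.rev i.rev) := by
  constructor
  · intro hX i j
    have h1 : X + sigma c X = 0 := hX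
    have h2 := congrFun (congrFun h1 i) j
    rw [Matrix.add_apply, sigma_apply] at h2
    exact eq_neg_of_add_eq_zero_left h2
  · intro hX
    change X + sigma c X = 0
    ext i j
    rw [Matrix.add_apply, sigma_apply, hX i j]
    simp

variable {c : F ≃ₐ[F₀] F}

theorem coe_inv_eq_sigma (g : U22 c) :
    (((g⁻¹ : U22 c) : GL (Fin 4) F) : Matrix (Fin 4) (Fin 4) F)
      = sigma c ((g : GL (Fin 4) F) : Matrix (Fin 4) (Fin 4) F) :=
  Units.inv_eq_of_mul_eq_one_right g.2

/-- The relation `X + σ(X) + X σ(X) = 0` satisfied by `X = g - 1`, for `g ∈ G`. -/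
theorem sub_one_add_sigma (g : U22 c) :
    (((g : GL (Fin 4) F) : Matrix (Fin 4) (Fin 4) F) - 1)
      + sigma c (((g : GL (Fin 4) F) : Matrix (Fin 4) (Fin 4) F) - 1)
      + (((g : GL (Fin 4) F) : Matrix (Fin 4) (Fin 4) F) - 1)
        * sigma c (((g : GL (Fin 4) F) : Matrix (Fin 4) (Fin 4) F) - 1) = 0 := by
  have hg : ((g : GL (Fin 4) F) : Matrix (Fin 4) (Fin 4) F)
      * sigma c ((g : GL (Fin 4) F) : Matrix (Fin 4) (Fin 4) F) = 1 := g.2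
  rw [sigma_sub, sigma_one, sub_mul, mul_sub, mul_sub, hg]
  simp only [mul_one, one_mul]
  abel

theorem coe_mul_sub_one (p q : U22 c) :
    (((p * q : U22 c) : GL (Fin 4) F) : Matrix (Fin 4) (Fin 4) F) - 1
      = (((p : GL (Fin 4) F) : Matrix (Fin 4) (Fin 4) F) - 1)
        + (((q : GL (Fin 4) F) : Matrix (Fin 4) (Fin 4) F) - 1)
        + (((p : GL (Fin 4) F) : Matrix (Fin 4) (Fin 4) F) - 1)
          * (((q : GL (Fin 4) F) : Matrix (Fin 4) (Fin 4) F) - 1) := by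
  rw [Subgroup.coe_mul, Units.val_mul]
  noncomm_ring

variable [ValuativeRel F] {ϖ s : F}

/-- The group `P_{Λ,n}` of a lattice sequence of the form `latSeq ϖ d`. -/
def congruenceSubgroup (h : IsUnramifiedPair c ϖ s) {d : Fin 4 → ℤ} {t : ℤ}
    (hd : ∀ j, d j + d j.rev = t) (n : ℕ) : Subgroup (U22 c) where
  carrier := P c (latSeq ϖ d) n
  one_mem' := by
    change ((1 : GL (Fin 4) F) : Matrix (Fin 4) (Fin 4) F) - 1 ∈ filtration _ _
    rw [Units.val_one, sub_self]
    intro i v _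
    simp
  mul_mem' := by
    intro p q hp hq
    change _ - 1 ∈ filtration _ _
    rw [coe_mul_sub_one]
    refine add_mem_filtration (add_mem_filtration hp hq) ?_
    exact filtration_latSeq_mono h (by omega) (mul_mem_filtration hp hq)
  inv_mem' := by
    intro p hp
    change _ - 1 ∈ filtration _ _
    rw [coe_inv_eq_sigma]
    have := sigma_mem_filtration h hd hp
    rwa [sigma_sub, sigma_one] at this

theorem trace_mem_of_mem_filtration (h : IsUnramifiedPair c ϖ s) {d : Fin 4 → ℤ} {n : ℤ}
    (hn : 1 ≤ n) {X : Matrix (Fin 4) (Fin 4) F} (hX : X ∈ filtration (latSeq ϖ d) n) :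
    X.trace ∈ fracIdeal ϖ 1 := by
  rw [mem_filtration_latSeq h] at hX
  exact sum_mem fun i _ => h.mono (by omega) (hX i i)

theorem psi_mul (h : IsUnramifiedPair c ϖ s) {d : Fin 4 → ℤ} {n : ℕ} (hn : 1 ≤ n)
    {Ω : AddChar F₀ Circle} (hΩ : ∀ x ∈ fracIdeal ϖ 1, traceChar F Ω x = 1)
    {β : Matrix (Fin 4) (Fin 4) F} (hβ : β ∈ filtration (latSeq ϖ d) (-(n : ℤ))) {p q : U22 c}
    (hp : p ∈ P c (latSeq ϖ d) n) (hq : q ∈ P c (latSeq ϖ d) n) :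
    psi c Ω β (p * q) = psi c Ω β p * psi c Ω β q := by
  have h1 := hΩ _ (trace_mem_of_mem_filtration h (n := -(n : ℤ) + (n + n)) (by omega)
    (mul_mem_filtration hβ (mul_mem_filtration hp hq)))
  rw [psi_eq, psi_eq, psi_eq, coe_mul_sub_one, mul_add, mul_add, Matrix.trace_add,
    Matrix.trace_add, AddChar.map_add_eq_mul, AddChar.map_add_eq_mul, h1, mul_one,
    Circle.coe_mul]

/-- The character `ψ_β` of `P_{Λ,n}`, for `β ∈ 𝔞_{-n}(Λ)`. -/
noncomputable def psiHom (h : IsUnramifiedPair c ϖ s) {d : Fin 4 → ℤ} {t : ℤ}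
    (hd : ∀ j, d j + d j.rev = t) {n : ℕ} (hn : 1 ≤ n)
    {Ω : AddChar F₀ Circle} (hΩ : ∀ x ∈ fracIdeal ϖ 1, traceChar F Ω x = 1)
    {β : Matrix (Fin 4) (Fin 4) F} (hβ : β ∈ filtration (latSeq ϖ d) (-(n : ℤ))) :
    congruenceSubgroup (c := c) h hd n →* ℂ where
  toFun p := psi c Ω β p
  map_one' := by simp [psi_eq]
  map_mul' p q := psi_mul h hn hΩ hβ p.2 q.2

variable {W : Type*} [AddCommGroup W] [Module ℂ W]

theorem ContainsStratum.conj {Ω : AddChar F₀ Circle} {π : Representation ℂ (U22 c) W}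
    {Λ : ℤ → Submodule 𝒪[F] (Fin 4 → F)} {r : ℕ} {β g : Matrix (Fin 4) (Fin 4) F}
    (hβ : ContainsStratum Ω π Λ r β) (hg : g * sigma c g = 1) (hgΛ : g ∈ filtration Λ 0)
    (hgΛ' : sigma c g ∈ filtration Λ 0) : ContainsStratum Ω π Λ r (g * β * sigma c g) := by
  obtain ⟨w, hw, hact⟩ := hβ
  have hg' : sigma c g * g = 1 := mul_eq_one_comm.1 hg
  let u : U22 c := ⟨⟨g, sigma c g, hg, hg'⟩, hg⟩
  have hu : ∀ x, π u⁻¹ (π u x) = x := fun x => by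
    rw [← Module.End.mul_apply, ← map_mul, inv_mul_cancel, map_one, Module.End.one_apply]
  refine ⟨π u w, fun h0 => hw ?_, fun p hp => ?_⟩
  · rw [← hu w, h0, map_zero]
  · have e : (((u⁻¹ * p * u : U22 c) : GL (Fin 4) F) : Matrix (Fin 4) (Fin 4) F) - 1
        = sigma c g * (((p : GL (Fin 4) F) : Matrix (Fin 4) (Fin 4) F) - 1) * g := by
      have e1 : (((u⁻¹ * p * u : U22 c) : GL (Fin 4) F) : Matrix (Fin 4) (Fin 4) F)
          = sigma c g * ((p : GL (Fin 4) F) : Matrix (Fin 4) (Fin 4) F) * g := rfl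
      rw [e1, mul_sub, sub_mul, mul_one, hg']
    have hp' : u⁻¹ * p * u ∈ P c Λ (r + 1) := by
      change _ - 1 ∈ filtration Λ _
      rw [e]
      have := mul_mem_filtration (mul_mem_filtration hgΛ' hp) hgΛ
      simpa using this
    have e2 : psi c Ω (g * β * sigma c g) p = psi c Ω β (u⁻¹ * p * u) := by
      rw [psi_eq, psi_eq, e]
      have e3 : β * (sigma c g * (((p : GL (Fin 4) F) : Matrix (Fin 4) (Fin 4) F) - 1) * g)
          = (β * sigma c g * (((p : GL (Fin 4) F) : Matrix (Fin 4) (Fin 4) F) - 1)) * g := by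
        simp only [Matrix.mul_assoc]
      rw [e3, Matrix.trace_mul_comm _ g]
      simp only [Matrix.mul_assoc]
    rw [e2, ← map_smul, ← hact _ hp', ← Module.End.mul_apply, ← map_mul, ← Module.End.mul_apply,
      ← map_mul]
    congr 2
    group

end CongruenceSubgroups

/-! ### Passing from one lattice sequence to the other -/


section Perturbation

variable {F₀ F : Type*} [Field F₀] [Field F] [Algebra F₀ F] {c : F ≃ₐ[F₀] F} {ϖ : F}

/-- Changing `β` in the positions `(3, 2)` and `(1, 4)`, dual to the extra entries. -/
def perturb (ϖ : F) (m : ℕ) (β : Matrix (Fin 4) (Fin 4) F) (x y : F) :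
    Matrix (Fin 4) (Fin 4) F :=
  β + Matrix.single 2 1 (ϖ ^ (1 - m : ℤ) * x) + Matrix.single 0 3 (ϖ ^ (-m : ℤ) * y)

theorem psi_perturb (Ω : AddChar F₀ Circle) {m : ℕ} (β : Matrix (Fin 4) (Fin 4) F) (x y : F)
    (p : U22 c) :
    let X := ((p : GL (Fin 4) F) : Matrix (Fin 4) (Fin 4) F) - 1
    psi c Ω (perturb ϖ m β x y) p = psi c Ω β p *
      (traceChar F Ω (x * (ϖ ^ (1 - m : ℤ) * X 1 2)) : ℂ) *
        (traceChar F Ω (y * (ϖ ^ (-m : ℤ) * X 3 0)) : ℂ) := by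
  intro X
  have e : (perturb ϖ m β x y * X).trace = (β * X).trace + x * (ϖ ^ (1 - m : ℤ) * X 1 2)
      + y * (ϖ ^ (-m : ℤ) * X 3 0) := by
    rw [perturb, add_mul, add_mul, Matrix.trace_add, Matrix.trace_add, Matrix.trace_single_mul,
      Matrix.trace_single_mul]
    simp only [smul_eq_mul]
    ring
  rw [psi_eq, psi_eq, e, AddChar.map_add_eq_mul, AddChar.map_add_eq_mul, Circle.coe_mul,
    Circle.coe_mul]

end Perturbation

section ChangeOfSequence

variable {F₀ F : Type*} [Field F₀] [Field F] [Algebra F₀ F] [ValuativeRel F]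
  {c : F ≃ₐ[F₀] F} {ϖ s : F}

theorem expN02_add_rev (j : Fin 4) : expN02 j + expN02 j.rev = 1 := by
  fin_cases j <;> rfl

theorem expN1_add_rev (j : Fin 4) : expN1 j + expN1 j.rev = 2 := by
  fin_cases j <;> rfl

/-- The two filtrations differ only by their conditions on four entries; for an element of `𝔤`,
two of these conditions follow from the two others. -/
theorem mem_filtration_expN02_of_mem_filtration_expN1 (h : IsUnramifiedPair c ϖ s) {m : ℕ} {n : ℕ}
    (hn : (n : ℤ) = 2 * m - 1) {β : Matrix (Fin 4) (Fin 4) F}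
    (hβ : β ∈ filtration (latSeq ϖ expN1) (-(n : ℤ))) (hβg : β ∈ lieG c)
    (h01 : β 0 1 ∈ fracIdeal ϖ (1 - m)) : β ∈ filtration (latSeq ϖ expN02) (-(n : ℤ)) := by
  rw [mem_filtration_latSeq h] at *
  have h23 : β 2 3 ∈ fracIdeal ϖ (1 - m) := by
    rw [mem_lieG_iff.1 hβg 2 3]
    exact neg_mem (h.conj_mem_fracIdeal h01)
  intro i j
  have hij := hβ i j
  fin_cases i <;> fin_cases j <;>
    first
    | refine h.mono ?_ hij
      simp [expN02, expN1] <;> omega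
    | refine h.mono ?_ h01
      simp [expN02]; omega
    | refine h.mono ?_ h23
      simp [expN02]; omega

/-- Of the conditions defining `𝔞_n(Λ')`, only those on the entries `(2, 3)` and `(4, 1)` are not
implied by membership in `𝔞_n(Λ)`. -/
theorem mem_filtration_expN1_of_mem_filtration_expN02 (h : IsUnramifiedPair c ϖ s) {m : ℕ} {n : ℕ}
    (hn : (n : ℤ) = 2 * m - 1) {X : Matrix (Fin 4) (Fin 4) F}
    (hX : X ∈ filtration (latSeq ϖ expN02) n) (h12 : X 1 2 ∈ fracIdeal ϖ m)
    (h30 : X 3 0 ∈ fracIdeal ϖ (m + 1)) : X ∈ filtration (latSeq ϖ expN1) n := by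
  rw [mem_filtration_latSeq h] at *
  intro i j
  have hij := hX i j
  fin_cases i <;> fin_cases j <;>
    first
    | refine h.mono ?_ hij
      simp [expN02, expN1] <;> omega
    | refine h.mono ?_ h12
      simp [expN1]; omega
    | refine h.mono ?_ h30
      simp [expN1]; omega

/-- The residue of `x` if `x ∈ 𝔬_F`, and zero otherwise. -/
noncomputable def residueOrZero (x : F) : 𝓀[F] :=
  open Classical in if hx : x ∈ 𝒪[F] then IsLocalRing.residue 𝒪[F] ⟨x, hx⟩ else 0

theorem residueOrZero_of_mem {x : F} (hx : x ∈ 𝒪[F]) :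
    residueOrZero x = IsLocalRing.residue 𝒪[F] ⟨x, hx⟩ := by
  rw [residueOrZero, dif_pos hx]

theorem residueOrZero_add {x y : F} (hx : x ∈ 𝒪[F]) (hy : y ∈ 𝒪[F]) :
    residueOrZero (x + y) = residueOrZero x + residueOrZero y := by
  rw [residueOrZero_of_mem hx, residueOrZero_of_mem hy, residueOrZero_of_mem (add_mem hx hy),
    ← map_add]
  rfl

theorem residueOrZero_eq_zero_iff (h : IsUnramifiedPair c ϖ s) {x : F} (hx : x ∈ 𝒪[F]) :
    residueOrZero x = 0 ↔ x ∈ fracIdeal ϖ 1 := by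
  rw [residueOrZero_of_mem hx, h.residue_eq_zero_iff]

theorem extra_entries_mem (h : IsUnramifiedPair c ϖ s) {m : ℕ} {n : ℕ}
    (hn : (n : ℤ) = 2 * m - 1) {X : Matrix (Fin 4) (Fin 4) F}
    (hX : X ∈ filtration (latSeq ϖ expN02) n) :
    ϖ ^ (1 - m : ℤ) * X 1 2 ∈ 𝒪[F] ∧ ϖ ^ (-m : ℤ) * X 3 0 ∈ 𝒪[F] := by
  rw [mem_filtration_latSeq h] at hX
  rw [← mem_fracIdeal_zero (ϖ := ϖ), ← mem_fracIdeal_zero (ϖ := ϖ), h.zpow_mul_mem_iff,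
    h.zpow_mul_mem_iff]
  constructor
  · refine h.mono ?_ (hX 1 2)
    simp [expN02]; omega
  · refine h.mono ?_ (hX 3 0)
    simp [expN02]; omega

theorem extra_entries_mem_one (h : IsUnramifiedPair c ϖ s) {m : ℕ} {n : ℕ}
    (hn : (n : ℤ) = 2 * m - 1) {X : Matrix (Fin 4) (Fin 4) F}
    (hX : X ∈ filtration (latSeq ϖ expN02) (n + n)) :
    ϖ ^ (1 - m : ℤ) * X 1 2 ∈ fracIdeal ϖ 1 ∧ ϖ ^ (-m : ℤ) * X 3 0 ∈ fracIdeal ϖ 1 := by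
  rw [mem_filtration_latSeq h] at hX
  rw [h.zpow_mul_mem_iff, h.zpow_mul_mem_iff]
  constructor
  · refine h.mono ?_ (hX 1 2)
    simp [expN02]; omega
  · refine h.mono ?_ (hX 3 0)
    simp [expN02]; omega

/-- The scaled entries `X₂₃` and `X₄₁` of `X = p - 1` modulo `𝔭_F`, as a homomorphism on `P_{Λ,n}`.
On its kernel the element `p` lies in the corresponding group of the other lattice sequence. -/
noncomputable def extraEntries (h : IsUnramifiedPair c ϖ s) {m : ℕ} {n : ℕ}
    (hn : (n : ℤ) = 2 * m - 1) :
    congruenceSubgroup (c := c) h expN02_add_rev n →* Multiplicative (𝓀[F] × 𝓀[F]) where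
  toFun p := Multiplicative.ofAdd
    (residueOrZero (ϖ ^ (1 - m : ℤ) *
        ((((p : U22 c) : GL (Fin 4) F) : Matrix (Fin 4) (Fin 4) F) - 1) 1 2),
      residueOrZero (ϖ ^ (-m : ℤ) *
        ((((p : U22 c) : GL (Fin 4) F) : Matrix (Fin 4) (Fin 4) F) - 1) 3 0))
  map_one' := by
    have h0 : residueOrZero (0 : F) = 0 :=
      (residueOrZero_eq_zero_iff h (zero_mem _)).2 (zero_mem _)
    simp only [OneMemClass.coe_one, Units.val_one, sub_self, Matrix.zero_apply, mul_zero, h0]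
    rfl
  map_mul' p q := by
    obtain ⟨hp1, hp2⟩ := extra_entries_mem h hn p.2
    obtain ⟨hq1, hq2⟩ := extra_entries_mem h hn q.2
    obtain ⟨h1, h2⟩ := extra_entries_mem_one h hn (mul_mem_filtration p.2 q.2)
    have h1' := mem_fracIdeal_zero.1 (h.mono zero_le_one h1)
    have h2' := mem_fracIdeal_zero.1 (h.mono zero_le_one h2)
    rw [← ofAdd_add, Prod.mk_add_mk, Subgroup.coe_mul, coe_mul_sub_one]
    simp only [Matrix.add_apply, mul_add]
    rw [residueOrZero_add (add_mem hp1 hq1) h1', residueOrZero_add hp1 hq1,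
      residueOrZero_add (add_mem hp2 hq2) h2', residueOrZero_add hp2 hq2,
      (residueOrZero_eq_zero_iff h h1').2 h1, (residueOrZero_eq_zero_iff h h2').2 h2, add_zero,
      add_zero]

theorem mem_ker_extraEntries (h : IsUnramifiedPair c ϖ s) {m : ℕ} {n : ℕ}
    (hn : (n : ℤ) = 2 * m - 1) (p : congruenceSubgroup (c := c) h expN02_add_rev n) :
    p ∈ (extraEntries h hn).ker ↔
      ϖ ^ (1 - m : ℤ) * ((((p : U22 c) : GL (Fin 4) F) : Matrix (Fin 4) (Fin 4) F) - 1) 1 2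
          ∈ fracIdeal ϖ 1 ∧
        ϖ ^ (-m : ℤ) * ((((p : U22 c) : GL (Fin 4) F) : Matrix (Fin 4) (Fin 4) F) - 1) 3 0
          ∈ fracIdeal ϖ 1 := by
  obtain ⟨hp1, hp2⟩ := extra_entries_mem h hn p.2
  rw [MonoidHom.mem_ker, ← residueOrZero_eq_zero_iff h hp1, ← residueOrZero_eq_zero_iff h hp2]
  exact Prod.mk_eq_zero

/-- Modulo `𝔭_F`, the two extra entries are antisymmetric under conjugation. -/
theorem extra_entries_add_conj_mem (h : IsUnramifiedPair c ϖ s) {m : ℕ} {n : ℕ}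
    (hn : (n : ℤ) = 2 * m - 1) {p : U22 c} (hp : p ∈ P c (latSeq ϖ expN02) n) :
    let X := ((p : GL (Fin 4) F) : Matrix (Fin 4) (Fin 4) F) - 1
    ϖ ^ (1 - m : ℤ) * X 1 2 + c (ϖ ^ (1 - m : ℤ) * X 1 2) ∈ fracIdeal ϖ 1 ∧
      ϖ ^ (-m : ℤ) * X 3 0 + c (ϖ ^ (-m : ℤ) * X 3 0) ∈ fracIdeal ϖ 1 := by
  intro X
  have hX : X ∈ filtration (latSeq ϖ expN02) n := hp
  have hrel : X + sigma c X + X * sigma c X = 0 := sub_one_add_sigma p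
  obtain ⟨h1, h2⟩ := extra_entries_mem_one h hn
    (mul_mem_filtration hX (sigma_mem_filtration h expN02_add_rev hX))
  have e : ∀ i j, X i j + c (X j.rev i.rev) = -(X * sigma c X) i j := by
    intro i j
    have := congrFun (congrFun hrel i) j
    rw [Matrix.add_apply, Matrix.add_apply, sigma_apply] at this
    exact eq_neg_of_add_eq_zero_left this
  constructor
  · have e1 : X 1 2 + c (X 1 2) = _ := e 1 2
    rw [map_mul, map_zpow₀, h.conj_unif, ← mul_add, e1, mul_neg]
    exact neg_mem h1
  · have e2 : X 3 0 + c (X 3 0) = _ := e 3 0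
    rw [map_mul, map_zpow₀, h.conj_unif, ← mul_add, e2, mul_neg]
    exact neg_mem h2

theorem single_mem_filtration (h : IsUnramifiedPair c ϖ s) {d : Fin 4 → ℤ} {k : ℤ} {i j : Fin 4}
    {x : F} (hx : x ∈ fracIdeal ϖ ((k + d i - d j + 1) / 2)) :
    Matrix.single i j x ∈ filtration (latSeq ϖ d) k := by
  rw [mem_filtration_latSeq h]
  intro i' j'
  rw [Matrix.single_apply]
  split_ifs with hij
  · rw [← hij.1, ← hij.2]; exact hx
  · exact zero_mem _

theorem perturb_mem_filtration (h : IsUnramifiedPair c ϖ s) {m : ℕ} {n : ℕ}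
    (hn : (n : ℤ) = 2 * m - 1) {d : Fin 4 → ℤ} (hd : d = expN02 ∨ d = expN1)
    {β : Matrix (Fin 4) (Fin 4) F} (hβ : β ∈ filtration (latSeq ϖ d) (-(n : ℤ))) {x y : F}
    (hx : x ∈ 𝒪[F]) (hy : y ∈ 𝒪[F]) :
    perturb ϖ m β x y ∈ filtration (latSeq ϖ d) (-(n : ℤ)) := by
  rw [← mem_fracIdeal_zero (ϖ := ϖ)] at hx hy
  refine add_mem_filtration (add_mem_filtration hβ ?_) ?_
  · refine single_mem_filtration h (h.zpow_mul_mem_iff.2 (h.mono ?_ hx))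
    rcases hd with rfl | rfl
    · simp [expN02]; omega
    · simp [expN1]; omega
  · refine single_mem_filtration h (h.zpow_mul_mem_iff.2 (h.mono ?_ hy))
    rcases hd with rfl | rfl
    · simp [expN02]; omega
    · simp [expN1]; omega

theorem perturb_mem_lieG (h : IsUnramifiedPair c ϖ s) {m : ℕ} {β : Matrix (Fin 4) (Fin 4) F}
    (hβ : β ∈ lieG c) {x y : F} (hx : c x = -x) (hy : c y = -y) :
    perturb ϖ m β x y ∈ lieG c := by
  have hβ' : β + sigma c β = 0 := hβ
  have e : ∀ (i j : Fin 4) (a : F), Matrix.single i j (-a) = -Matrix.single i j a := fun i j a => by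
    ext k l; rw [Matrix.neg_apply, Matrix.single_apply, Matrix.single_apply]; split_ifs <;> simp
  change perturb ϖ m β x y + sigma c (perturb ϖ m β x y) = 0
  rw [perturb, sigma_add, sigma_add, sigma_single, sigma_single, map_mul, map_mul, map_zpow₀,
    map_zpow₀, h.conj_unif, hx, hy, mul_neg, mul_neg, e, e]
  have r1 : (1 : Fin 4).rev = 2 := rfl
  have r2 : (2 : Fin 4).rev = 1 := rfl
  have r3 : (3 : Fin 4).rev = 0 := rfl
  have r0 : (0 : Fin 4).rev = 3 := rfl
  rw [r1, r2, r3, r0, ← hβ']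
  abel

variable {W : Type*} [AddCommGroup W] [Module ℂ W]

/-- Passage from one lattice sequence to the other. If the entry `(1, 2)` of `β` is as small as
the second lattice sequence demands, then `ψ_β` extends to its group `P_{Λ,n}`, the extensions
being parametrized by the positions `(3, 2)` and `(1, 4)` of `β`, and one of them occurs in `π`. -/
theorem exists_containsStratum_perturb [Finite 𝓀[F]] (h : IsUnramifiedPair c ϖ s) {m : ℕ}
    {n : ℕ} (hn : (n : ℤ) = 2 * m - 1) {Ω : AddChar F₀ Circle}
    (hΩ : ∀ x ∈ fracIdeal ϖ 1, traceChar F Ω x = 1) {B : Type*} [Fintype B] [Nonempty B]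
    {t : B → F} (ht : ∀ b, t b ∈ 𝒪[F])
    (hsum : ∀ z ∈ 𝒪[F], z ∉ fracIdeal ϖ 1 → z + c z ∈ fracIdeal ϖ 1 →
      ∑ b, (traceChar F Ω (t b * z) : ℂ) = 0)
    {π : Representation ℂ (U22 c) W} {β : Matrix (Fin 4) (Fin 4) F}
    (hβ : β ∈ filtration (latSeq ϖ expN02) (-(n : ℤ)))
    (hcont : ContainsStratum Ω π (latSeq ϖ expN1) (n - 1) β) :
    ∃ b b' : B, ContainsStratum Ω π (latSeq ϖ expN02) (n - 1) (perturb ϖ m β (t b) (t b')) := by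
  have hn1 : n - 1 + 1 = n := by omega
  obtain ⟨w, hw, hact⟩ := hcont
  rw [hn1] at hact
  let Q := congruenceSubgroup (c := c) h expN02_add_rev n
  let χ : B × B → Q →* ℂ := fun b => psiHom h expN02_add_rev (by omega) hΩ
    (perturb_mem_filtration h hn (Or.inl rfl) hβ (ht b.1) (ht b.2))
  have hχ : ∀ b (p : Q), χ b p = psi c Ω (perturb ϖ m β (t b.1) (t b.2)) p := fun _ _ => rfl
  have hK : ∀ b, ∀ p ∈ (extraEntries h hn).ker, (π.comp Q.subtype) p w = χ b p • w := by
    intro b p hp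
    obtain ⟨h1, h2⟩ := (mem_ker_extraEntries h hn p).1 hp
    rw [hχ, psi_perturb, hΩ _ (h.mul_mem_of_le (mem_fracIdeal_zero.2 (ht _)) h1 (by norm_num)),
      hΩ _ (h.mul_mem_of_le (mem_fracIdeal_zero.2 (ht _)) h2 (by norm_num)), Circle.coe_one,
      mul_one, mul_one]
    refine hact _ (mem_filtration_expN1_of_mem_filtration_expN02 h hn p.2 ?_ ?_)
    · rw [h.zpow_mul_mem_iff] at h1
      exact h.mono (by omega) h1
    · rw [h.zpow_mul_mem_iff] at h2
      exact h.mono (by omega) h2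
  have hoff : ∀ p, p ∉ (extraEntries h hn).ker → ∑ b, χ b p = 0 := by
    intro p hp
    rw [mem_ker_extraEntries] at hp
    obtain ⟨hX1, hX2⟩ := extra_entries_mem h hn p.2
    obtain ⟨hc1, hc2⟩ := extra_entries_add_conj_mem h hn p.2
    simp only [hχ, psi_perturb]
    rw [Fintype.sum_prod_type]
    simp only [mul_assoc, ← Finset.mul_sum]
    rw [← Finset.sum_mul]
    by_cases h1 : ϖ ^ (1 - m : ℤ) *
        ((((p : U22 c) : GL (Fin 4) F) : Matrix (Fin 4) (Fin 4) F) - 1) 1 2 ∈ fracIdeal ϖ 1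
    · rw [hsum _ hX2 (fun h2 => hp ⟨h1, h2⟩) hc2]
      simp
    · rw [hsum _ hX1 h1 hc1]
      simp
  obtain ⟨b, w', hw', hact'⟩ := exists_eigenvector_of_sum_eq_zero (π.comp Q.subtype)
    (extraEntries h hn).ker χ hw hK hoff
  refine ⟨b.1, b.2, w', hw', fun p hp => ?_⟩
  rw [hn1] at hp
  exact hact' ⟨p, hp⟩

end ChangeOfSequence

/-! ### Determinants and characteristic polynomials of strata -/


theorem yElt_eq {F : Type*} [Field F] {ϖ : F} {n m : ℕ} (hn : (n : ℤ) = 2 * m - 1)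
    (β : Matrix (Fin 4) (Fin 4) F) :
    yElt ϖ 2 n β = ϖ ^ n • β ^ 2 := by
  have h1 : Nat.gcd 2 n = 1 := by
    rw [← Nat.coprime_iff_gcd_eq_one, Nat.coprime_two_left, ← Int.odd_coe_nat, hn]
    exact ⟨m - 1, by ring⟩
  rw [yElt, h1, Nat.div_one, Nat.div_one]

section BlockMatrices

variable {k : Type*} [Field k]

theorem det_of_antidiagonal_blocks {M : Matrix (Fin 4) (Fin 4) k} (h00 : M 0 0 = 0)
    (h01 : M 0 1 = 0) (h10 : M 1 0 = 0) (h11 : M 1 1 = 0) (h12 : M 1 2 = 0) (h30 : M 3 0 = 0) :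
    M.det = M 0 2 * M 1 3 * M 2 0 * M 3 1 := by
  have e : M = !![0, 0, M 0 2, M 0 3; 0, 0, 0, M 1 3; M 2 0, M 2 1, M 2 2, M 2 3;
      0, M 3 1, M 3 2, M 3 3] := by
    ext i j
    fin_cases i <;> fin_cases j <;> simp [h00, h01, h10, h11, h12, h30]
  conv_lhs => rw [e]
  simp [Matrix.det_succ_row_zero, Fin.sum_univ_succ, Fin.succAbove]
  ring

/-- The characteristic polynomial of a matrix which is block triangular for the partition
`{1, 4}`, `{2, 3}` of the indices. -/
theorem charpoly_of_block {M : Matrix (Fin 4) (Fin 4) k} (h10 : M 1 0 = 0) (h13 : M 1 3 = 0)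
    (h20 : M 2 0 = 0) (h23 : M 2 3 = 0) :
    M.charpoly = (X ^ 2 - C (M 0 0 + M 3 3) * X + C (M 0 0 * M 3 3 - M 0 3 * M 3 0)) *
      (X ^ 2 - C (M 1 1 + M 2 2) * X + C (M 1 1 * M 2 2 - M 1 2 * M 2 1)) := by
  have e : M.charmatrix = !![X - C (M 0 0), -C (M 0 1), -C (M 0 2), -C (M 0 3);
      0, X - C (M 1 1), -C (M 1 2), 0; 0, -C (M 2 1), X - C (M 2 2), 0;
      -C (M 3 0), -C (M 3 1), -C (M 3 2), X - C (M 3 3)] := by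
    ext i j : 2
    fin_cases i <;> fin_cases j <;> simp [h10, h13, h20, h23]
  rw [Matrix.charpoly, e]
  simp only [C_add, C_sub, C_mul]
  simp [Matrix.det_succ_row_zero, Fin.sum_univ_succ, Fin.succAbove]
  ring

theorem discr_eq_of_sq_eq (h2 : (2 : k) ≠ 0) {t d l l' : k}
    (h : (X ^ 2 - C t * X + C d) * (X ^ 2 - C t * X + C d) =
      (X - C l) ^ 2 * (X - C l') ^ 2) : t ^ 2 - 4 * d = (l - l') ^ 2 := by
  have h1 : (X ^ 2 - C t * X + C d) ^ 2 = (X ^ 2 - C (l + l') * X + C (l * l')) ^ 2 := by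
    rw [pow_two, h, C_add, C_mul]; ring
  have hc : ∀ a b : k, (X ^ 2 - C a * X + C b).coeff 2 = 1 ∧
      (X ^ 2 - C a * X + C b).coeff 1 = -a ∧ (X ^ 2 - C a * X + C b).coeff 0 = b := by
    intro a b
    simp [coeff_X, coeff_C, coeff_X_pow]
  obtain ⟨a2, a1, a0⟩ := hc t d
  obtain ⟨b2, b1, b0⟩ := hc (l + l') (l * l')
  rcases sq_eq_sq_iff_eq_or_eq_neg.1 h1 with h3 | h3
  · rw [h3, b1] at a1
    rw [h3, b0] at a0
    rw [← neg_inj.1 a1, ← a0]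
    ring
  · exfalso
    apply h2
    rw [h3, coeff_neg, b2] at a2
    linear_combination -a2

end BlockMatrices

section Determinant

variable {F₀ F : Type*} [Field F₀] [Field F] [Algebra F₀ F] [ValuativeRel F]
  {c : F ≃ₐ[F₀] F} {ϖ s : F}

/-- The leading term of the determinant: only the entries `(1, 3)`, `(2, 4)`, `(3, 1)`, `(4, 2)`
contribute. -/
theorem exists_det_eq (h : IsUnramifiedPair c ϖ s) {n m : ℕ} (hn : (n : ℤ) = 2 * m - 1)
    {β : Matrix (Fin 4) (Fin 4) F} (hβ : β ∈ filtration (latSeq ϖ expN1) (-(n : ℤ)))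
    (hβ' : β ∈ filtration (latSeq ϖ expN02) (-(n : ℤ))) :
    ∃ D : 𝒪[F], β.det = ϖ ^ (2 - 4 * m : ℤ) * D ∧ IsLocalRing.residue 𝒪[F] D =
      residueOrZero (ϖ ^ (m : ℤ) * β 0 2) * residueOrZero (ϖ ^ (m : ℤ) * β 1 3) *
        residueOrZero (ϖ ^ (m - 1 : ℤ) * β 2 0) * residueOrZero (ϖ ^ (m - 1 : ℤ) * β 3 1) := by
  rw [mem_filtration_latSeq h] at hβ hβ'
  let u : Fin 4 → ℤ := ![m, m, m - 1, m - 1]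
  have hint : ∀ i j, ϖ ^ u i * β i j ∈ 𝒪[F] := by
    intro i j
    rw [← mem_fracIdeal_zero (ϖ := ϖ), h.zpow_mul_mem_iff]
    have := hβ' i j
    refine h.mono ?_ this
    fin_cases i <;> fin_cases j <;> simp [u, expN02] <;> omega
  let Q : Matrix (Fin 4) (Fin 4) 𝒪[F] := Matrix.of fun i j => ⟨ϖ ^ u i * β i j, hint i j⟩
  have hQ : (Q.map (algebraMap 𝒪[F] F)) = Matrix.of fun i j => ϖ ^ u i * β i j := rfl
  refine ⟨Q.det, ?_, ?_⟩
  · have e : ((Q.det : 𝒪[F]) : F) = (∏ i, ϖ ^ u i) * β.det := by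
      have := RingHom.map_det (algebraMap 𝒪[F] F) Q
      rw [RingHom.mapMatrix_apply, hQ, Matrix.det_mul_column] at this
      exact this
    have e2 : (∏ i, ϖ ^ u i) = ϖ ^ (4 * m - 2 : ℤ) := by
      rw [Fin.prod_univ_four, ← zpow_add₀ h.unif_ne_zero, ← zpow_add₀ h.unif_ne_zero,
        ← zpow_add₀ h.unif_ne_zero]
      congr 1
      simp [u]; ring
    rw [e, e2, ← mul_assoc, ← zpow_add₀ h.unif_ne_zero]
    ring_nf
    simp
  · have hz : ∀ i j, β i j ∈ fracIdeal ϖ (1 - u i) →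
        (IsLocalRing.residue 𝒪[F]).mapMatrix Q i j = 0 := by
      intro i j hij
      exact (h.residue_eq_zero_iff _).2 (h.zpow_mul_mem_iff.2 hij)
    have hv : ∀ i j, (IsLocalRing.residue 𝒪[F]).mapMatrix Q i j
        = residueOrZero (ϖ ^ u i * β i j) := fun i j =>
      (residueOrZero_of_mem (hint i j)).symm
    rw [RingHom.map_det, det_of_antidiagonal_blocks, hv, hv, hv, hv]
    · rfl
    all_goals apply hz
    · exact h.mono (by simp [u, expN02]; omega) (hβ' 0 0)
    · exact h.mono (by simp [u, expN02]; omega) (hβ' 0 1)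
    · exact h.mono (by simp [u, expN02]; omega) (hβ' 1 0)
    · exact h.mono (by simp [u, expN02]; omega) (hβ' 1 1)
    · exact h.mono (by simp [u, expN1]; omega) (hβ 1 2)
    · exact h.mono (by simp [u, expN1]; omega) (hβ 3 0)

/-- A nonzero constant term of the characteristic polynomial means that the leading term of `det β`
does not vanish. -/
theorem coeff_zero_stratumCharpoly (h : IsUnramifiedPair c ϖ s) {n m : ℕ}
    (hn : (n : ℤ) = 2 * m - 1) {β : Matrix (Fin 4) (Fin 4) F} {φ : 𝓀[F][X]}
    (hφ : IsStratumCharpoly ϖ 2 n β φ) {D : 𝒪[F]} (hD : β.det = ϖ ^ (2 - 4 * m : ℤ) * D) :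
    φ.coeff 0 = IsLocalRing.residue 𝒪[F] D ^ 2 := by
  obtain ⟨Φ, hΦ, rfl⟩ := hφ
  rw [coeff_map, ← map_pow]
  congr 1
  have h1 : algebraMap 𝒪[F] F (Φ.coeff 0) = (yElt ϖ 2 n β).det := by
    rw [← coeff_map, hΦ, Matrix.det_eq_sign_charpoly_coeff, Fintype.card_fin,
      Even.neg_one_pow (by decide), one_mul]
  apply Subtype.ext
  refine h1.trans ?_
  rw [yElt_eq hn, Matrix.det_smul, Matrix.det_pow, hD, Fintype.card_fin, mul_pow, ← mul_assoc,
    ← zpow_natCast, ← zpow_natCast, ← zpow_mul, ← zpow_natCast (ϖ ^ _) 2, ← zpow_mul,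
    ← zpow_add₀ h.unif_ne_zero, hn]
  have e : (2 * (m : ℤ) - 1) * (4 : ℕ) + (2 - 4 * m) * (2 : ℕ) = 0 := by push_cast; ring
  rw [e, zpow_zero, one_mul]
  rfl

theorem exists_isStratumCharpoly (h : IsUnramifiedPair c ϖ s) {n m : ℕ}
    (hn : (n : ℤ) = 2 * m - 1) {β : Matrix (Fin 4) (Fin 4) F}
    (hβ : β ∈ filtration (latSeq ϖ expN02) (-(n : ℤ))) :
    ∃ φ : 𝓀[F][X], IsStratumCharpoly ϖ 2 n β φ := by
  have h2 := mul_mem_filtration hβ hβ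
  rw [mem_filtration_latSeq h] at h2
  have hint : ∀ i j, (yElt ϖ 2 n β) i j ∈ 𝒪[F] := by
    intro i j
    rw [yElt_eq hn, pow_two, Matrix.smul_apply, smul_eq_mul, ← mem_fracIdeal_zero (ϖ := ϖ),
      ← zpow_natCast, h.zpow_mul_mem_iff]
    refine h.mono ?_ (h2 i j)
    fin_cases i <;> fin_cases j <;> simp [expN02] <;> omega
  let Y : Matrix (Fin 4) (Fin 4) 𝒪[F] := Matrix.of fun i j => ⟨_, hint i j⟩
  refine ⟨_, Y.charpoly, ?_, rfl⟩
  rw [← Matrix.charpoly_map]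
  rfl

/-- Perturbing `β` does not change its leading determinant. -/
theorem isFundamental_perturb (h : IsUnramifiedPair c ϖ s) {n m : ℕ} (hn : (n : ℤ) = 2 * m - 1)
    {β : Matrix (Fin 4) (Fin 4) F} (hβ : β ∈ filtration (latSeq ϖ expN1) (-(n : ℤ)))
    (hβ' : β ∈ filtration (latSeq ϖ expN02) (-(n : ℤ))) (hβg : β ∈ lieG c) {φ : 𝓀[F][X]}
    (hφ : IsStratumCharpoly ϖ 2 n β φ) (hφ0 : φ.coeff 0 ≠ 0) {x y : F} (hx : x ∈ 𝒪[F])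
    (hy : y ∈ 𝒪[F]) (hxc : c x = -x) (hyc : c y = -y) :
    IsFundamentalSkewStratum c ϖ (latSeq ϖ expN02) 2 n (n - 1) (perturb ϖ m β x y) := by
  have hp := perturb_mem_filtration h hn (Or.inr rfl) hβ hx hy
  have hp' := perturb_mem_filtration h hn (Or.inl rfl) hβ' hx hy
  refine ⟨⟨latSeq_isLatticeSequence h expN02, by omega, latSeq_isSelfDual h expN02_add_rev, hp',
    perturb_mem_lieG h hβg hxc hyc⟩, ?_⟩
  obtain ⟨φ', hφ'⟩ := exists_isStratumCharpoly h hn hp'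
  refine ⟨φ', hφ', ?_⟩
  obtain ⟨D, hD, hDr⟩ := exists_det_eq h hn hβ hβ'
  obtain ⟨D', hD', hDr'⟩ := exists_det_eq h hn hp hp'
  have e02 : perturb ϖ m β x y 0 2 = β 0 2 := by simp [perturb]
  have e13 : perturb ϖ m β x y 1 3 = β 1 3 := by simp [perturb]
  have e20 : perturb ϖ m β x y 2 0 = β 2 0 := by simp [perturb]
  have e31 : perturb ϖ m β x y 3 1 = β 3 1 := by simp [perturb]
  rw [e02, e13, e20, e31, ← hDr] at hDr'
  have h0 := coeff_zero_stratumCharpoly h hn hφ' hD'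
  rw [hDr', ← coeff_zero_stratumCharpoly h hn hφ hD] at h0
  rintro rfl
  rw [← h0] at hφ0
  simp at hφ0

end Determinant

/-! ### The discriminant of the stratum -/


section Discriminant

variable {F₀ F : Type*} [Field F₀] [Field F] [Algebra F₀ F] [ValuativeRel F]
  {c : F ≃ₐ[F₀] F} {ϖ s : F}

theorem IsStratumCharpoly.conj {n m : ℕ} (hn : (n : ℤ) = 2 * m - 1)
    {β g g' : Matrix (Fin 4) (Fin 4) F} (hg : g' * g = 1) {φ : 𝓀[F][X]}
    (hφ : IsStratumCharpoly ϖ 2 n β φ) : IsStratumCharpoly ϖ 2 n (g * β * g') φ := by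
  obtain ⟨Φ, hΦ, hφ⟩ := hφ
  refine ⟨Φ, hΦ.trans ?_, hφ⟩
  rw [yElt_eq hn, yElt_eq hn]
  have e : ϖ ^ n • (g * β * g') ^ 2 = g * (ϖ ^ n • β ^ 2 * g') := by
    rw [pow_two, pow_two, Matrix.smul_mul, Matrix.mul_smul]
    congr 1
    calc g * β * g' * (g * β * g') = g * β * (g' * g) * β * g' := by simp only [Matrix.mul_assoc]
      _ = _ := by rw [hg]; simp only [Matrix.mul_assoc, Matrix.one_mul]
  rw [e, Matrix.charpoly_mul_comm, Matrix.mul_assoc, hg, Matrix.mul_one]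

/-- The exponents `expN1` after conjugation by `diag(1, 1, 1, ϖ)`. -/
def expN1' : Fin 4 → ℤ := ![0, 1, 1, 0]

/-- The characteristic polynomial of the stratum is the square of the one of the `2 × 2` block
`T` of `ϖⁿ β²` at the indices `2, 3`. If its roots are `λ, λ'`, this gives the discriminant of `T`
modulo `𝔭_F`. -/
theorem discr_mem (h : IsUnramifiedPair c ϖ s) {n m : ℕ} (hn : (n : ℤ) = 2 * m - 1)
    {β : Matrix (Fin 4) (Fin 4) F} (hβ : β ∈ filtration (latSeq ϖ expN1) (-(n : ℤ)))
    (hβg : β ∈ lieG c) {φ : 𝓀[F][X]} (hφ : IsStratumCharpoly ϖ 2 n β φ) {l l' : 𝒪[F]}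
    (hl : φ = (X - C (IsLocalRing.residue 𝒪[F] l)) ^ 2 *
      (X - C (IsLocalRing.residue 𝒪[F] l')) ^ 2) {a b p q : F}
    (ha : a = ϖ ^ (m : ℤ) * β 0 1) (hb : b = ϖ ^ (m : ℤ) * β 0 2)
    (hp : p = ϖ ^ (m - 1 : ℤ) * β 3 1) (hq : q = ϖ ^ (m - 1 : ℤ) * β 3 2) :
    (c p * b + c a * q - (c q * a + c b * p)) ^ 2
      + 4 * (c q * b + c b * q) * (c p * a + c a * p) - (l - l') ^ 2 ∈ fracIdeal ϖ 1 := by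
  have h0 := h.unif_ne_zero
  let ε : Fin 4 → ℤ := ![0, 0, 0, 1]
  let B : Matrix (Fin 4) (Fin 4) F :=
    Matrix.diagonal (fun i => ϖ ^ (-ε i)) * β * Matrix.diagonal (fun i => ϖ ^ ε i)
  have hBa : ∀ i j, B i j = ϖ ^ (-ε i) * β i j * ϖ ^ ε j := fun i j => by
    simp only [B, Matrix.mul_diagonal, Matrix.diagonal_mul]
  have hBφ : IsStratumCharpoly ϖ 2 n B φ := by
    refine hφ.conj hn ?_
    rw [Matrix.diagonal_mul_diagonal, ← Matrix.diagonal_one]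
    congr 1
    funext i
    rw [← zpow_add₀ h0, add_neg_cancel, zpow_zero]
  rw [mem_filtration_latSeq h] at hβ
  have hB : B ∈ filtration (latSeq ϖ expN1') (-(n : ℤ)) := by
    rw [mem_filtration_latSeq h]
    intro i j
    rw [hBa, mul_assoc, mul_comm (β i j), h.zpow_mul_mem_iff, h.zpow_mul_mem_iff]
    refine h.mono ?_ (hβ i j)
    fin_cases i <;> fin_cases j <;> simp [expN1, expN1', ε] <;> omega
  have hBB := mul_mem_filtration hB hB
  rw [mem_filtration_latSeq h] at hB hBB
  have hent : ∀ i j (t : ℤ), t ≤ (-(n : ℤ) + -n + expN1' i - expN1' j + 1) / 2 + n →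
      ϖ ^ n * (B * B) i j ∈ fracIdeal ϖ t := by
    intro i j t hle
    rw [← zpow_natCast, h.zpow_mul_mem_iff]
    exact h.mono (by omega) (hBB i j)
  let Y : Matrix (Fin 4) (Fin 4) 𝒪[F] := Matrix.of fun i j =>
    ⟨ϖ ^ n * (B * B) i j, mem_fracIdeal_zero.1 (hent i j 0 (by
      fin_cases i <;> fin_cases j <;> simp [expN1'] <;> omega))⟩
  let M := (IsLocalRing.residue 𝒪[F]).mapMatrix Y
  have hMφ : φ = M.charpoly := by
    obtain ⟨Φ, hΦ, rfl⟩ := hBφ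
    have e : Φ = Y.charpoly := by
      apply Polynomial.map_injective (algebraMap 𝒪[F] F) Subtype.val_injective
      rw [hΦ, ← Matrix.charpoly_map, yElt_eq hn, pow_two]
      rfl
    rw [e, ← Matrix.charpoly_map]
    rfl
  have hM : ∀ i j (t : 𝒪[F]), ϖ ^ n * (B * B) i j - t ∈ fracIdeal ϖ 1 →
      M i j = IsLocalRing.residue 𝒪[F] t := by
    intro i j t hij
    rw [← sub_eq_zero]
    change IsLocalRing.residue 𝒪[F] (Y i j) - _ = 0
    rw [← map_sub]
    exact (h.residue_eq_zero_iff _).2 hij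
  have hM0 : ∀ i j, 1 ≤ (-(n : ℤ) + -n + expN1' i - expN1' j + 1) / 2 + n → M i j = 0 := by
    intro i j hle
    rw [hM i j 0, map_zero]
    simpa using hent i j 1 hle
  have hpow : ϖ ^ n = ϖ ^ (m - 1 : ℤ) * ϖ ^ (m : ℤ) := by
    rw [← zpow_natCast, hn, ← zpow_add₀ h0]
    congr 1; ring
  have hpow' : ϖ ^ (m : ℤ) = ϖ ^ (m - 1 : ℤ) * ϖ := by
    rw [← zpow_add_one₀ h0]
    congr 1; ring
  -- Products of two entries of `B` from the diagonal blocks are negligible.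
  have hneg : ∀ i j k l, expN1' i = expN1' j → expN1' k = expN1' l → ϖ ^ n * (B i j * B k l) ∈ fracIdeal ϖ 1 := by
    intro i j k l hij hkl
    rw [← zpow_natCast, h.zpow_mul_mem_iff]
    exact h.mul_mem_of_le (hB i j) (hB k l) (by omega)
  have hg := mem_lieG_iff.1 hβg
  have hc : ∀ (k : ℤ) (x : F), c (ϖ ^ k * x) = ϖ ^ k * c x := fun k x => by
    rw [map_mul, map_zpow₀, h.conj_unif]
  have g10 : ϖ ^ (m - 1 : ℤ) * β 1 0 = -c q := by rw [hq, hc, hg 1 0, mul_neg]; rfl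
  have g13 : ϖ ^ (m : ℤ) * β 1 3 = -c b := by rw [hb, hc, hg 1 3, mul_neg]; rfl
  have g20 : ϖ ^ (m - 1 : ℤ) * β 2 0 = -c p := by rw [hp, hc, hg 2 0, mul_neg]; rfl
  have g23 : ϖ ^ (m : ℤ) * β 2 3 = -c a := by rw [ha, hc, hg 2 3, mul_neg]; rfl
  have hma : a ∈ 𝒪[F] := by
    rw [ha, ← mem_fracIdeal_zero (ϖ := ϖ), h.zpow_mul_mem_iff]
    exact h.mono (by simp [expN1]; omega) (hβ 0 1)
  have hmb : b ∈ 𝒪[F] := by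
    rw [hb, ← mem_fracIdeal_zero (ϖ := ϖ), h.zpow_mul_mem_iff]
    exact h.mono (by simp [expN1]; omega) (hβ 0 2)
  have hmp : p ∈ 𝒪[F] := by
    rw [hp, ← mem_fracIdeal_zero (ϖ := ϖ), h.zpow_mul_mem_iff]
    exact h.mono (by simp [expN1]; omega) (hβ 3 1)
  have hmq : q ∈ 𝒪[F] := by
    rw [hq, ← mem_fracIdeal_zero (ϖ := ϖ), h.zpow_mul_mem_iff]
    exact h.mono (by simp [expN1]; omega) (hβ 3 2)
  lift a to 𝒪[F] using hma
  lift b to 𝒪[F] using hmb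
  lift p to 𝒪[F] using hmp
  lift q to 𝒪[F] using hmq
  obtain ⟨a', ha'⟩ : ∃ x : 𝒪[F], (x : F) = c a := ⟨⟨_, h.conj_mem _ a.2⟩, rfl⟩
  obtain ⟨b', hb'⟩ : ∃ x : 𝒪[F], (x : F) = c b := ⟨⟨_, h.conj_mem _ b.2⟩, rfl⟩
  obtain ⟨p', hp'⟩ : ∃ x : 𝒪[F], (x : F) = c p := ⟨⟨_, h.conj_mem _ p.2⟩, rfl⟩
  obtain ⟨q', hq'⟩ : ∃ x : 𝒪[F], (x : F) = c q := ⟨⟨_, h.conj_mem _ q.2⟩, rfl⟩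
  rw [← ha'] at g23 ⊢
  rw [← hb'] at g13 ⊢
  rw [← hp'] at g20 ⊢
  rw [← hq'] at g10 ⊢
  have q1 : (q' : F) = -(ϖ ^ (m - 1 : ℤ) * β 1 0) := by rw [g10, neg_neg]
  have q2 : (b' : F) = -(ϖ ^ (m : ℤ) * β 1 3) := by rw [g13, neg_neg]
  have q3 : (p' : F) = -(ϖ ^ (m - 1 : ℤ) * β 2 0) := by rw [g20, neg_neg]
  have q4 : (a' : F) = -(ϖ ^ (m : ℤ) * β 2 3) := by rw [g23, neg_neg]
  have B01 : B 0 1 = β 0 1 := by rw [hBa]; simp [ε]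
  have B02 : B 0 2 = β 0 2 := by rw [hBa]; simp [ε]
  have B10 : B 1 0 = β 1 0 := by rw [hBa]; simp [ε]
  have B20 : B 2 0 = β 2 0 := by rw [hBa]; simp [ε]
  have B13 : B 1 3 = β 1 3 * ϖ := by rw [hBa]; simp [ε]
  have B23 : B 2 3 = β 2 3 * ϖ := by rw [hBa]; simp [ε]
  have B31 : B 3 1 = ϖ⁻¹ * β 3 1 := by rw [hBa]; simp [ε]
  have B32 : B 3 2 = ϖ⁻¹ * β 3 2 := by rw [hBa]; simp [ε]
  have M11 : M 1 1 = IsLocalRing.residue 𝒪[F] (-(q' * a + b' * p)) := by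
    apply hM
    convert add_mem (hneg 1 1 1 1 rfl rfl) (hneg 1 2 2 1 rfl rfl) using 1
    rw [Matrix.mul_apply, Fin.sum_univ_four, B10, B01, B13, B31]
    simp only [Subring.coe_neg, Subring.coe_add, Subring.coe_mul, ha, hp, q1, q2,
      hpow, hpow']
    field_simp
    ring
  have M12 : M 1 2 = IsLocalRing.residue 𝒪[F] (-(q' * b + b' * q)) := by
    apply hM
    convert add_mem (hneg 1 1 1 2 rfl rfl) (hneg 1 2 2 2 rfl rfl) using 1
    rw [Matrix.mul_apply, Fin.sum_univ_four, B10, B02, B13, B32]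
    simp only [Subring.coe_neg, Subring.coe_add, Subring.coe_mul, hb, hq, q1, q2,
      hpow, hpow']
    field_simp
    ring
  have M21 : M 2 1 = IsLocalRing.residue 𝒪[F] (-(p' * a + a' * p)) := by
    apply hM
    convert add_mem (hneg 2 1 1 1 rfl rfl) (hneg 2 2 2 1 rfl rfl) using 1
    rw [Matrix.mul_apply, Fin.sum_univ_four, B20, B01, B23, B31]
    simp only [Subring.coe_neg, Subring.coe_add, Subring.coe_mul, ha, hp, q3, q4,
      hpow, hpow']
    field_simp
    ring
  have M22 : M 2 2 = IsLocalRing.residue 𝒪[F] (-(p' * b + a' * q)) := by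
    apply hM
    convert add_mem (hneg 2 1 1 2 rfl rfl) (hneg 2 2 2 2 rfl rfl) using 1
    rw [Matrix.mul_apply, Fin.sum_univ_four, B20, B02, B23, B32]
    simp only [Subring.coe_neg, Subring.coe_add, Subring.coe_mul, hb, hq, q3, q4,
      hpow, hpow']
    field_simp
    ring
  have M00 : M 0 0 = IsLocalRing.residue 𝒪[F] (-(a * q' + b * p')) := by
    apply hM
    convert add_mem (hneg 0 0 0 0 rfl rfl) (hneg 0 3 3 0 rfl rfl) using 1
    rw [Matrix.mul_apply, Fin.sum_univ_four, B01, B10, B02, B20]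
    simp only [Subring.coe_neg, Subring.coe_add, Subring.coe_mul, ha, hb, q1, q3,
      hpow, hpow']
    field_simp
    ring
  have M03 : M 0 3 = IsLocalRing.residue 𝒪[F] (-(a * b' + b * a')) := by
    apply hM
    convert add_mem (hneg 0 0 0 3 rfl rfl) (hneg 0 3 3 3 rfl rfl) using 1
    rw [Matrix.mul_apply, Fin.sum_univ_four, B01, B13, B02, B23]
    simp only [Subring.coe_neg, Subring.coe_add, Subring.coe_mul, ha, hb, q2, q4,
      hpow, hpow']
    field_simp
    ring
  have M30 : M 3 0 = IsLocalRing.residue 𝒪[F] (-(p * q' + q * p')) := by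
    apply hM
    convert add_mem (hneg 3 0 0 0 rfl rfl) (hneg 3 3 3 0 rfl rfl) using 1
    rw [Matrix.mul_apply, Fin.sum_univ_four, B31, B10, B32, B20]
    simp only [Subring.coe_neg, Subring.coe_add, Subring.coe_mul, hp, hq, q1, q3,
      hpow, hpow']
    field_simp
    ring
  have M33 : M 3 3 = IsLocalRing.residue 𝒪[F] (-(p * b' + q * a')) := by
    apply hM
    convert add_mem (hneg 3 0 0 3 rfl rfl) (hneg 3 3 3 3 rfl rfl) using 1
    rw [Matrix.mul_apply, Fin.sum_univ_four, B31, B13, B32, B23]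
    simp only [Subring.coe_neg, Subring.coe_add, Subring.coe_mul, hp, hq, q2, q4,
      hpow, hpow']
    field_simp
    ring
  have hsq := hMφ.symm.trans hl
  rw [charpoly_of_block (hM0 1 0 (by simp [expN1']; omega)) (hM0 1 3 (by simp [expN1']; omega))
    (hM0 2 0 (by simp [expN1']; omega)) (hM0 2 3 (by simp [expN1']; omega))] at hsq
  have htr : M 0 0 + M 3 3 = M 1 1 + M 2 2 := by
    rw [M00, M33, M11, M22]; simp only [map_neg, map_add, map_mul]; ring
  have hdet : M 0 0 * M 3 3 - M 0 3 * M 3 0 = M 1 1 * M 2 2 - M 1 2 * M 2 1 := by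
    rw [M00, M33, M03, M30, M11, M22, M12, M21]; simp only [map_neg, map_add, map_mul]; ring
  rw [htr, hdet] at hsq
  have h2 : (2 : 𝓀[F]) ≠ 0 := by
    intro h2
    have h3 : IsLocalRing.residue 𝒪[F] 2 = 0 := by rw [map_ofNat, h2]
    exact h.notMem_of_inv_mem h.two_ne_zero h.inv_two_mem ((h.residue_eq_zero_iff 2).1 h3)
  have hdisc := discr_eq_of_sq_eq h2 hsq
  rw [M11, M22, M12, M21] at hdisc
  refine (h.residue_eq_zero_iff ((p' * b + a' * q - (q' * a + b' * p)) ^ 2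
    + 4 * (q' * b + b' * q) * (p' * a + a' * p) - (l - l') ^ 2)).1 ?_
  simp only [map_neg, map_add, map_mul, map_sub, map_pow, map_ofNat] at hdisc ⊢
  linear_combination hdisc

end Discriminant

/-! ### Conjugation to isotropic position -/


section GroupElements

variable {F₀ F : Type*} [Field F₀] [Field F] [Algebra F₀ F] {c : F ≃ₐ[F₀] F} {ϖ : F}

/-- The element of `U(2,2)` exchanging `e₂` and `e₃`. -/
def swapInner (F : Type*) [Field F] : Matrix (Fin 4) (Fin 4) F :=
  !![1, 0, 0, 0; 0, 0, 1, 0; 0, 1, 0, 0; 0, 0, 0, 1]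

/-- The element of `U(2,2)` exchanging `e₁` and `ϖ e₄`. -/
def swapOuter (ϖ : F) : Matrix (Fin 4) (Fin 4) F :=
  !![0, 0, 0, ϖ⁻¹; 0, 1, 0, 0; 0, 0, 1, 0; ϖ, 0, 0, 0]

/-- The unipotent element of `U(2,2)` sending `e₂` to `e₂ - x e₃`, for `x̄ = -x`. -/
def unipotentInner (x : F) : Matrix (Fin 4) (Fin 4) F :=
  !![1, 0, 0, 0; 0, 1, 0, 0; 0, -x, 1, 0; 0, 0, 0, 1]

/-- The unipotent element of `U(2,2)` sending `ϖ e₄` to `ϖ e₄ + z e₁`, for `z̄ = -z`. -/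
def unipotentOuter (ϖ z : F) : Matrix (Fin 4) (Fin 4) F :=
  !![1, 0, 0, z * ϖ⁻¹; 0, 1, 0, 0; 0, 0, 1, 0; 0, 0, 0, 1]

theorem sigma_swapInner : sigma c (swapInner F) = swapInner F := by
  ext i j
  rw [sigma_apply]
  fin_cases i <;> fin_cases j <;> simp [swapInner, Fin.rev]

theorem sigma_swapOuter (hϖ : c ϖ = ϖ) :
    sigma c (swapOuter ϖ) = swapOuter ϖ := by
  ext i j
  rw [sigma_apply]
  fin_cases i <;> fin_cases j <;> simp [swapOuter, Fin.rev, hϖ]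

theorem sigma_unipotentInner {x : F} (hx : c x = -x) :
    sigma c (unipotentInner x) = unipotentInner (-x) := by
  ext i j
  rw [sigma_apply]
  fin_cases i <;> fin_cases j <;> simp [unipotentInner, Fin.rev, hx]

theorem sigma_unipotentOuter (hϖ : c ϖ = ϖ) {z : F} (hz : c z = -z) :
    sigma c (unipotentOuter ϖ z) = unipotentOuter ϖ (-z) := by
  ext i j
  rw [sigma_apply]
  fin_cases i <;> fin_cases j <;> simp [unipotentOuter, Fin.rev, hz, hϖ]

end GroupElements

section Conjugation

variable {F₀ F : Type*} [Field F₀] [Field F] [Algebra F₀ F] [ValuativeRel F]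
  {c : F ≃ₐ[F₀] F} {ϖ s : F} {W : Type*} [AddCommGroup W] [Module ℂ W]

/-- `β` defines a skew stratum `[Λ', n, n - 1, β]` with characteristic polynomial `φ` which is
contained in `π`. -/
structure IsContainedStratum (c : F ≃ₐ[F₀] F) (ϖ : F) (Ω : AddChar F₀ Circle)
    (π : Representation ℂ (U22 c) W) (n : ℕ) (φ : 𝓀[F][X]) (β : Matrix (Fin 4) (Fin 4) F) :
    Prop where
  mem_filtration : β ∈ filtration (latSeq ϖ expN1) (-(n : ℤ))
  mem_lieG : β ∈ lieG c
  isStratumCharpoly : IsStratumCharpoly ϖ 2 n β φ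
  containsStratum : ContainsStratum Ω π (latSeq ϖ expN1) (n - 1) β

variable {Ω : AddChar F₀ Circle} {π : Representation ℂ (U22 c) W} {n m : ℕ} {φ : 𝓀[F][X]}
  {β : Matrix (Fin 4) (Fin 4) F}

theorem sigma_sigma (h : IsUnramifiedPair c ϖ s) (X : Matrix (Fin 4) (Fin 4) F) :
    sigma c (sigma c X) = X := by
  ext i j
  rw [sigma_apply, sigma_apply, h.conj_conj, Fin.rev_rev, Fin.rev_rev]

theorem IsContainedStratum.conj (h : IsUnramifiedPair c ϖ s) (hn : (n : ℤ) = 2 * m - 1)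
    (hβ : IsContainedStratum c ϖ Ω π n φ β) {g : Matrix (Fin 4) (Fin 4) F}
    (hg : g * sigma c g = 1) (hgΛ : g ∈ filtration (latSeq ϖ expN1) 0) :
    IsContainedStratum c ϖ Ω π n φ (g * β * sigma c g) where
  mem_filtration := by
    have := mul_mem_filtration (mul_mem_filtration hgΛ hβ.mem_filtration)
      (sigma_mem_filtration h expN1_add_rev hgΛ)
    simpa using this
  mem_lieG := by
    have h1 : β + sigma c β = 0 := hβ.mem_lieG
    change g * β * sigma c g + sigma c (g * β * sigma c g) = 0
    rw [sigma_mul, sigma_mul, sigma_sigma h, ← Matrix.mul_assoc g, ← add_mul, ← mul_add, h1]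
    simp
  isStratumCharpoly := hβ.isStratumCharpoly.conj hn (mul_eq_one_comm.1 hg)
  containsStratum := hβ.containsStratum.conj hg hgΛ (sigma_mem_filtration h expN1_add_rev hgΛ)

theorem IsContainedStratum.swapInner (h : IsUnramifiedPair c ϖ s) (hn : (n : ℤ) = 2 * m - 1)
    (hβ : IsContainedStratum c ϖ Ω π n φ β) :
    ∃ γ, IsContainedStratum c ϖ Ω π n φ γ ∧ γ 0 1 = β 0 2 ∧ γ 3 1 = β 3 2 := by
  refine ⟨_, hβ.conj h hn (g := UnitaryStrata.swapInner F) ?_ ?_, ?_, ?_⟩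
  · rw [sigma_swapInner]
    ext i j
    fin_cases i <;> fin_cases j <;>
      simp [UnitaryStrata.swapInner, Matrix.mul_apply, Fin.sum_univ_four]
  · rw [mem_filtration_latSeq h]
    intro i j
    fin_cases i <;> fin_cases j <;>
      simp [UnitaryStrata.swapInner, expN1, mem_fracIdeal_zero, one_mem]
  all_goals
    rw [sigma_swapInner]
    simp [UnitaryStrata.swapInner, Matrix.mul_apply, Matrix.vecMul, dotProduct, Fin.sum_univ_four]

theorem IsContainedStratum.swapOuter (h : IsUnramifiedPair c ϖ s) (hn : (n : ℤ) = 2 * m - 1)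
    (hβ : IsContainedStratum c ϖ Ω π n φ β) :
    ∃ γ, IsContainedStratum c ϖ Ω π n φ γ ∧ γ 0 1 = ϖ⁻¹ * β 3 1 := by
  have h0 := h.unif_ne_zero
  refine ⟨_, hβ.conj h hn (g := UnitaryStrata.swapOuter ϖ) ?_ ?_, ?_⟩
  · rw [sigma_swapOuter h.conj_unif]
    ext i j
    fin_cases i <;> fin_cases j <;>
      simp [UnitaryStrata.swapOuter, Matrix.mul_apply, Fin.sum_univ_four, h0]
  · rw [mem_filtration_latSeq h]
    have h1 := h.zpow_mem 1
    have h2 := h.zpow_mem (-1)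
    rw [zpow_one] at h1
    rw [zpow_neg_one] at h2
    intro i j
    fin_cases i <;> fin_cases j <;>
      simp [UnitaryStrata.swapOuter, expN1, mem_fracIdeal_zero, one_mem, h1, h2]
  · rw [sigma_swapOuter h.conj_unif]
    simp [UnitaryStrata.swapOuter, Matrix.mul_apply, Matrix.vecMul, dotProduct, Fin.sum_univ_four]

theorem IsContainedStratum.unipotentInner (h : IsUnramifiedPair c ϖ s)
    (hn : (n : ℤ) = 2 * m - 1) (hβ : IsContainedStratum c ϖ Ω π n φ β) {x : F} (hx : x ∈ 𝒪[F])
    (hxc : c x = -x) :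
    ∃ γ, IsContainedStratum c ϖ Ω π n φ γ ∧ γ 0 1 = β 0 1 + x * β 0 2 ∧
      γ 3 1 = β 3 1 + x * β 3 2 := by
  refine ⟨_, hβ.conj h hn (g := UnitaryStrata.unipotentInner x) ?_ ?_, ?_, ?_⟩
  · rw [sigma_unipotentInner hxc]
    ext i j
    fin_cases i <;> fin_cases j <;>
      simp [UnitaryStrata.unipotentInner, Matrix.mul_apply, Fin.sum_univ_four]
  · rw [mem_filtration_latSeq h]
    intro i j
    fin_cases i <;> fin_cases j <;>
      simp [UnitaryStrata.unipotentInner, expN1, mem_fracIdeal_zero, one_mem, hx]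
  all_goals
    rw [sigma_unipotentInner hxc]
    simp [UnitaryStrata.unipotentInner, Matrix.mul_apply, Matrix.vecMul, dotProduct, Fin.sum_univ_four]
    ring

theorem IsContainedStratum.unipotentOuter (h : IsUnramifiedPair c ϖ s)
    (hn : (n : ℤ) = 2 * m - 1) (hβ : IsContainedStratum c ϖ Ω π n φ β) {z : F} (hz : z ∈ 𝒪[F])
    (hzc : c z = -z) :
    ∃ γ, IsContainedStratum c ϖ Ω π n φ γ ∧ γ 0 1 = β 0 1 + z * ϖ⁻¹ * β 3 1 := by
  refine ⟨_, hβ.conj h hn (g := UnitaryStrata.unipotentOuter ϖ z) ?_ ?_, ?_⟩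
  · rw [sigma_unipotentOuter h.conj_unif hzc]
    ext i j
    fin_cases i <;> fin_cases j <;>
      simp [UnitaryStrata.unipotentOuter, Matrix.mul_apply, Fin.sum_univ_four]
  · rw [mem_filtration_latSeq h]
    have h2 := h.mul_mem (mem_fracIdeal_zero.2 hz) (h.zpow_mem (-1))
    rw [zpow_neg_one, zero_add] at h2
    intro i j
    fin_cases i <;> fin_cases j <;>
      simp [UnitaryStrata.unipotentOuter, expN1, mem_fracIdeal_zero, one_mem, h2]
  · rw [sigma_unipotentOuter h.conj_unif hzc]
    simp [UnitaryStrata.unipotentOuter, Matrix.mul_apply, Matrix.vecMul, dotProduct, Fin.sum_univ_four]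

/-- After conjugation, `β` maps `e₂` to an isotropic vector modulo `𝔭_F`: the discriminant
condition makes the quadratic equation for `x` in `e₂ + x e₃` solvable with `x̄ = -x`. -/
theorem IsContainedStratum.exists_isotropic (h : IsUnramifiedPair c ϖ s)
    (hn : (n : ℤ) = 2 * m - 1) (hβ : IsContainedStratum c ϖ Ω π n φ β) {l l' : 𝒪[F]}
    (hφ : φ = (X - C (IsLocalRing.residue 𝒪[F] l)) ^ 2 *
      (X - C (IsLocalRing.residue 𝒪[F] l')) ^ 2) (hll' : c (l - l') = -(l - l' : F)) :
    ∃ γ, IsContainedStratum c ϖ Ω π n φ γ ∧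
      c (ϖ ^ (m - 1 : ℤ) * γ 3 1) * (ϖ ^ (m : ℤ) * γ 0 1)
        + c (ϖ ^ (m : ℤ) * γ 0 1) * (ϖ ^ (m - 1 : ℤ) * γ 3 1) ∈ fracIdeal ϖ 1 := by
  have hdisc := discr_mem h hn hβ.mem_filtration hβ.mem_lieG hβ.isStratumCharpoly hφ rfl rfl rfl
    rfl
  have hmem := (mem_filtration_latSeq h).1 hβ.mem_filtration
  obtain ⟨a, ha⟩ : ∃ a, a = ϖ ^ (m : ℤ) * β 0 1 := ⟨_, rfl⟩
  obtain ⟨b, hb⟩ : ∃ a, a = ϖ ^ (m : ℤ) * β 0 2 := ⟨_, rfl⟩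
  obtain ⟨p, hp⟩ : ∃ a, a = ϖ ^ (m - 1 : ℤ) * β 3 1 := ⟨_, rfl⟩
  obtain ⟨q, hq⟩ : ∃ a, a = ϖ ^ (m - 1 : ℤ) * β 3 2 := ⟨_, rfl⟩
  rw [← ha, ← hb, ← hp, ← hq] at hdisc
  have hma : a ∈ 𝒪[F] := by
    rw [ha, ← mem_fracIdeal_zero (ϖ := ϖ), h.zpow_mul_mem_iff]
    exact h.mono (by simp [expN1]; omega) (hmem 0 1)
  have hmb : b ∈ 𝒪[F] := by
    rw [hb, ← mem_fracIdeal_zero (ϖ := ϖ), h.zpow_mul_mem_iff]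
    exact h.mono (by simp [expN1]; omega) (hmem 0 2)
  have hmp : p ∈ 𝒪[F] := by
    rw [hp, ← mem_fracIdeal_zero (ϖ := ϖ), h.zpow_mul_mem_iff]
    exact h.mono (by simp [expN1]; omega) (hmem 3 1)
  have hmq : q ∈ 𝒪[F] := by
    rw [hq, ← mem_fracIdeal_zero (ϖ := ϖ), h.zpow_mul_mem_iff]
    exact h.mono (by simp [expN1]; omega) (hmem 3 2)
  have hca := h.conj_mem _ hma
  have hcb := h.conj_mem _ hmb
  have hcp := h.conj_mem _ hmp
  have hcq := h.conj_mem _ hmq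
  have h2 := h.two_ne_zero
  by_cases hT : c q * b + c b * q ∈ fracIdeal ϖ 1
  · obtain ⟨γ, hγ, h01, h31⟩ := hβ.swapInner h hn
    refine ⟨γ, hγ, ?_⟩
    rw [h01, h31, ← hb, ← hq]
    exact hT
  · set T := c q * b + c b * q with hTdef
    have hTm : T ∈ 𝒪[F] := add_mem (mul_mem hcq hmb) (mul_mem hcb hmq)
    obtain ⟨hT0, hTi⟩ := h.inv_mem_of_notMem hTm hT
    have hTc : c T = T := by
      rw [hTdef, map_add, map_mul, map_mul, h.conj_conj, h.conj_conj]; ring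
    set δ := c p * b + c a * q - (c q * a + c b * p) with hδ
    have hδm : δ ∈ 𝒪[F] := sub_mem (add_mem (mul_mem hcp hmb) (mul_mem hca hmq))
      (add_mem (mul_mem hcq hma) (mul_mem hcb hmp))
    have hδc : c δ = -δ := by
      simp only [hδ, map_sub, map_add, map_mul, h.conj_conj]; ring
    -- A root of `(p̄ a + ā p) + δ x - T x²` modulo `𝔭_F`, by the discriminant condition.
    let x : F := (δ + (l - l')) * 2⁻¹ * T⁻¹
    have hx : x ∈ 𝒪[F] := mul_mem (mul_mem (add_mem hδm (sub_mem l.2 l'.2))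
      h.inv_two_mem) hTi
    have hxc : c x = -x := by
      simp only [x, map_mul, map_add, map_inv₀, hTc, hδc, hll', map_ofNat]
      ring
    obtain ⟨γ, hγ, h01, h31⟩ := hβ.unipotentInner h hn hx hxc
    refine ⟨γ, hγ, ?_⟩
    have e1 : ϖ ^ (m : ℤ) * γ 0 1 = a + x * b := by rw [h01, ha, hb]; ring
    have e2 : ϖ ^ (m - 1 : ℤ) * γ 3 1 = p + x * q := by rw [h31, hp, hq]; ring
    rw [e1, e2]
    have e3 : c (p + x * q) * (a + x * b) + c (a + x * b) * (p + x * q)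
        = (δ ^ 2 + 4 * T * (c p * a + c a * p) - (l - l') ^ 2) * (2⁻¹ * 2⁻¹ * T⁻¹) := by
      have e4 : c (p + x * q) * (a + x * b) + c (a + x * b) * (p + x * q)
          = (c p * a + c a * p) + x * δ - x ^ 2 * T := by
        simp only [map_add, map_mul, hxc, hδ, hTdef]; ring
      rw [e4]
      simp only [x]
      field_simp
      ring
    rw [e3]
    exact h.mul_mem_of_le hdisc (mem_fracIdeal_zero.2
      (mul_mem (mul_mem h.inv_two_mem h.inv_two_mem) hTi)) (by norm_num)

/-- After a further conjugation, `β` maps `e₂` into the line of `ϖ e₄` modulo `𝔭_F`. -/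
theorem IsContainedStratum.exists_entry_mem (h : IsUnramifiedPair c ϖ s)
    (hn : (n : ℤ) = 2 * m - 1) (hβ : IsContainedStratum c ϖ Ω π n φ β)
    (hiso : c (ϖ ^ (m - 1 : ℤ) * β 3 1) * (ϖ ^ (m : ℤ) * β 0 1)
        + c (ϖ ^ (m : ℤ) * β 0 1) * (ϖ ^ (m - 1 : ℤ) * β 3 1) ∈ fracIdeal ϖ 1) :
    ∃ γ, IsContainedStratum c ϖ Ω π n φ γ ∧ γ 0 1 ∈ fracIdeal ϖ (1 - m) := by
  have h0 := h.unif_ne_zero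
  have hmem := (mem_filtration_latSeq h).1 hβ.mem_filtration
  have hpow : ϖ ^ (m : ℤ) * ϖ⁻¹ = ϖ ^ (m - 1 : ℤ) := by rw [zpow_sub_one₀ h0]
  obtain ⟨a, ha⟩ : ∃ a, a = ϖ ^ (m : ℤ) * β 0 1 := ⟨_, rfl⟩
  obtain ⟨p, hp⟩ : ∃ a, a = ϖ ^ (m - 1 : ℤ) * β 3 1 := ⟨_, rfl⟩
  rw [← ha, ← hp] at hiso
  have hma : a ∈ 𝒪[F] := by
    rw [ha, ← mem_fracIdeal_zero (ϖ := ϖ), h.zpow_mul_mem_iff]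
    exact h.mono (by simp [expN1]; omega) (hmem 0 1)
  have hmp : p ∈ 𝒪[F] := by
    rw [hp, ← mem_fracIdeal_zero (ϖ := ϖ), h.zpow_mul_mem_iff]
    exact h.mono (by simp [expN1]; omega) (hmem 3 1)
  by_cases hpm : p ∈ fracIdeal ϖ 1
  · obtain ⟨γ, hγ, h01⟩ := hβ.swapOuter h hn
    refine ⟨γ, hγ, ?_⟩
    rw [← h.zpow_mul_mem_iff (i := m), h01, ← mul_assoc, hpow, ← hp]
    exact hpm
  · obtain ⟨hp0, hpi⟩ := h.inv_mem_of_notMem hmp hpm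
    have hcp0 : c p ≠ 0 := (map_ne_zero_iff _ c.injective).2 hp0
    have h2 := h.two_ne_zero
    -- The antisymmetric part of `-a / p`; its symmetric part vanishes modulo `𝔭_F`.
    let z : F := (-(a * p⁻¹) + c a * (c p)⁻¹) * 2⁻¹
    have hcpi : (c p)⁻¹ ∈ 𝒪[F] := by
      rw [← map_inv₀]; exact h.conj_mem _ hpi
    have hz : z ∈ 𝒪[F] := mul_mem (add_mem (neg_mem (mul_mem hma hpi))
      (mul_mem (h.conj_mem _ hma) hcpi)) h.inv_two_mem
    have hzc : c z = -z := by
      simp only [z, map_mul, map_add, map_neg, map_inv₀, h.conj_conj, map_ofNat]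
      ring
    obtain ⟨γ, hγ, h01⟩ := hβ.unipotentOuter h hn hz hzc
    refine ⟨γ, hγ, ?_⟩
    rw [← h.zpow_mul_mem_iff (i := m), h01]
    have e : ϖ ^ (m : ℤ) * (β 0 1 + z * ϖ⁻¹ * β 3 1)
        = (c p * a + c a * p) * (2⁻¹ * (c p)⁻¹) := by
      have e1 : ϖ ^ (m : ℤ) * (β 0 1 + z * ϖ⁻¹ * β 3 1) = a + z * p := by
        rw [ha, hp, ← hpow]; ring
      rw [e1]
      simp only [z]
      field_simp
      ring
    rw [e]
    exact h.mul_mem_of_le hiso (mem_fracIdeal_zero.2 (mul_mem h.inv_two_mem hcpi)) (by norm_num)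

end Conjugation

section Types

variable {F₀ F : Type*} [Field F₀] [Field F] [Algebra F₀ F] [ValuativeRel F₀] [ValuativeRel F]
  {c : F ≃ₐ[F₀] F} {ϖ s : F}

/-- In both types the characteristic polynomial is `(X - λ)² (X - λ')²` with nonzero `λ`, `λ'`
having lifts whose difference is antisymmetric. -/
theorem exists_roots_of_type [ValuativeExtension F₀ F] (h : IsUnramifiedPair c ϖ s) {φ : 𝓀[F][X]}
    (hφ : IsTypeA c φ ∨ IsTypeC F₀ φ) :
    ∃ l l' : 𝒪[F], φ = (X - C (IsLocalRing.residue 𝒪[F] l)) ^ 2 *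
      (X - C (IsLocalRing.residue 𝒪[F] l')) ^ 2 ∧ c (l - l') = -(l - l' : F) ∧
      φ.coeff 0 ≠ 0 := by
  have hcoeff : ∀ a b : 𝓀[F], ((X - C a) ^ 2 * (X - C b) ^ 2).coeff 0 = a ^ 2 * b ^ 2 := by
    intro a b
    simp [coeff_zero_eq_eval_zero]
  rcases hφ with ⟨l, l', hl', hne, rfl⟩ | ⟨a, a', ha, haa', rfl⟩
  · have hconj : ∀ x y : 𝒪[F], (y : F) = c x → IsLocalRing.residue 𝒪[F] x = 0 →
        IsLocalRing.residue 𝒪[F] y = 0 := by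
      intro x y hxy hx
      rw [h.residue_eq_zero_iff] at hx ⊢
      rw [hxy]
      exact h.conj_mem_fracIdeal hx
    have hl : (l : F) = c l' := by rw [hl', h.conj_conj]
    refine ⟨l, l', rfl, ?_, ?_⟩
    · rw [map_sub, ← hl', ← hl]; ring
    · rw [hcoeff]
      refine mul_ne_zero (pow_ne_zero 2 fun h0 => hne ?_) (pow_ne_zero 2 fun h0 => hne ?_)
      · rw [h0, hconj l l' hl' h0]
      · rw [h0, hconj l' l hl h0]
  · refine ⟨a', a', by ring, by simp, ?_⟩
    have e : (X - C (IsLocalRing.residue 𝒪[F] a')) ^ 4 =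
        (X - C (IsLocalRing.residue 𝒪[F] a')) ^ 2 * (X - C (IsLocalRing.residue 𝒪[F] a')) ^ 2 := by
      ring
    rw [e, hcoeff]
    have hu : IsUnit a' := by
      obtain ⟨h0, h1⟩ := (isUnit_integer_iff a).1 ha
      rw [isUnit_integer_iff, haa', ← map_inv₀]
      exact ⟨(map_ne_zero_iff _ (algebraMap F₀ F).injective).2 h0,
        algebraMap_mem_integer_iff.2 h1⟩
    have := (IsLocalRing.residue_ne_zero_iff_isUnit a').2 hu
    exact mul_ne_zero (pow_ne_zero 2 this) (pow_ne_zero 2 this)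

end Types

end UnitaryStrata

theorem lemma4p1
    {F₀ F : Type*}
    [Field F₀] [ValuativeRel F₀] [TopologicalSpace F₀] [IsNonarchimedeanLocalField F₀]
    [Field F] [ValuativeRel F] [TopologicalSpace F] [IsNonarchimedeanLocalField F]
    [Algebra F₀ F] [ValuativeExtension F₀ F]
    (hodd : ringChar 𝓀[F₀] ≠ 2)
    (ε : 𝒪[F₀]) (hε : IsUnit ε) (hε' : ¬ IsSquare ε)
    (sqrtε : F) (hsqrt : sqrtε ^ 2 = algebraMap F₀ F ε)
    (hF : Algebra.adjoin F₀ {sqrtε} = ⊤)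
    (c : F ≃ₐ[F₀] F) (hc : c ≠ AlgEquiv.refl)
    (ϖ : 𝒪[F₀]) (hϖ : Irreducible ϖ)
    (Ω : AddChar F₀ Circle) (hΩ : UnitaryStrata.HasConductorPrime Ω)
    (m : ℕ) (hm : 0 < m) (n : ℕ) (hn : n = 2 * m - 1)
    {W : Type*} [AddCommGroup W] [Module ℂ W]
    (π : Representation ℂ (UnitaryStrata.U22 c) W)
    (hirr : π.IsIrreducible) (hsmooth : UnitaryStrata.IsSmoothRep π)
    (β' : Matrix (Fin 4) (Fin 4) F)
    (hβ' : UnitaryStrata.IsFundamentalSkewStratum c (algebraMap F₀ F ϖ)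
      (UnitaryStrata.seqN1 c (algebraMap F₀ F ϖ)) 2 n (n - 1) β')
    (hφ : ∃ φ : Polynomial 𝓀[F],
      UnitaryStrata.IsStratumCharpoly (algebraMap F₀ F ϖ) 2 n β' φ ∧
      (UnitaryStrata.IsTypeA c φ ∨ UnitaryStrata.IsTypeC F₀ φ))
    (hcont : UnitaryStrata.ContainsStratum Ω π
      (UnitaryStrata.seqN1 c (algebraMap F₀ F ϖ)) (n - 1) β') :
    ∃ β : Matrix (Fin 4) (Fin 4) F,
      UnitaryStrata.IsFundamentalSkewStratum c (algebraMap F₀ F ϖ)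
        (UnitaryStrata.seqN0N2 (algebraMap F₀ F ϖ)) 2 n (n - 1) β ∧
      UnitaryStrata.ContainsStratum Ω π
        (UnitaryStrata.seqN0N2 (algebraMap F₀ F ϖ)) (n - 1) β := by
  open UnitaryStrata in
  have h := isUnramifiedPair hodd hε hε' hsqrt hF hc hϖ
  have hn' : (n : ℤ) = 2 * m - 1 := by omega
  have hΩ1 : ∀ x ∈ fracIdeal (algebraMap F₀ F ϖ) 1, traceChar F Ω x = 1 := fun x hx =>
    traceChar_eq_one hodd hε hε' hsqrt hF hc hϖ hΩ hx
  rw [seqN1_eq h] at hβ' hcont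
  rw [seqN0N2_eq h]
  obtain ⟨φ, hφβ, hφt⟩ := hφ
  obtain ⟨l, l', hφl, hll', hφ0⟩ := exists_roots_of_type h hφt
  have hβ₀ : IsContainedStratum c (algebraMap F₀ F ϖ) Ω π n φ β' :=
    ⟨hβ'.1.mem_filtration, hβ'.1.mem_lieG, hφβ, hcont⟩
  obtain ⟨β₁, hβ₁, hiso⟩ := hβ₀.exists_isotropic h hn' hφl hll'
  obtain ⟨β₂, hβ₂, h01⟩ := hβ₁.exists_entry_mem h hn' hiso
  have hβ₂' := mem_filtration_expN02_of_mem_filtration_expN1 h hn' hβ₂.mem_filtration hβ₂.mem_lieG h01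
  have := Fintype.ofFinite 𝓀[F₀]
  have ht : ∀ b : 𝓀[F₀], algebraMap F₀ F (residueLift b) * sqrtε ∈ 𝒪[F] := fun b =>
    mul_mem (algebraMap_mem_integer_iff.2 (residueLift b).2) h.sqrt_mem
  have htc : ∀ b : 𝓀[F₀], c (algebraMap F₀ F (residueLift b) * sqrtε)
      = -(algebraMap F₀ F (residueLift b) * sqrtε) := fun b => by
    rw [map_mul, AlgEquiv.commutes, h.conj_sqrt, mul_neg]
  obtain ⟨b, b', hb⟩ := exists_containsStratum_perturb h hn' hΩ1 ht
    (fun z hz hz1 hz2 => sum_traceChar_eq_zero hodd hε hε' hsqrt hF hc hϖ hΩ hz hz1 hz2)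
    hβ₂' hβ₂.containsStratum
  exact ⟨_, isFundamental_perturb h hn' hβ₂.mem_filtration hβ₂' hβ₂.mem_lieG
    hβ₂.isStratumCharpoly hφ0 (ht b) (ht b') (htc b) (htc b'), hb⟩
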